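/- Let $\mathcal{L}$ be the lips tangle: the topological space obtained from five disjoint copies $e_1,\dots,e_5$ of $[0,1]$ by identifying endpoints (with the quotient topology) so that there are exactly three vertices $a,b,c$, with $e_1,e_2$ joining $a$ to $b$, $e_3,e_4$ joining $b$ to $c$, and $e_5$ joining $a$ to $c$. The empty set counts as a connected subset. For $z=(x_1,y_1,\dots,x_5,y_5)\in\mathbb{R}^{10}$ let $X(z)\subseteq\mathcal{L}$ be the union over $i$ of the images in $\mathcal{L}$ of the sets $[x_i,y_i]\cap[0,1]$ in $e_i$ (where $[x_i,y_i]=\emptyset$ if $y_i<x_i$). A valuation $\nu$ assigns a real number $\nu(X)\ge 0$ to every connected subset $X$ of $\mathcal{L}$; it is called monotone continuous if (1) $\nu(\emptyset)=0$ and $\nu(X)\le\nu(Y)$ whenever $X\subseteq Y$ are connected subsets of $\mathcal{L}$, and (2) the function $z\mapsto\nu(X(z))$ is continuous on the set of all $z\in\mathbb{R}^{10}$ for which $X(z)$ is connected. Theorem. Let $\nu_1,\nu_2,\nu_3$ be monotone continuous valuations on $\mathcal{L}$. Then there is a connected envy-free allocation of $\mathcal{L}$ to the three agents: a partition of $\mathcal{L}$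 into three pairwise disjoint, nonempty, connected subsets $T_1,T_2,T_3$ with union $\mathcal{L}$ such that $\nu_i(T_i)\ge\nu_i(T_j)$ for all $i,j\in\{1,2,3\}$. -/

import Mathlib

open Set
open scoped unitInterval NNReal

noncomputable section

namespace Tangle

/-- A point of the disjoint union of `m` copies of `[0,1]` is sent to the vertex it is attached to
if it is an endpoint of its copy (`0` of copy `e` is attached to `src e`, and `1` to `tgt e`), and
to itself otherwise. -/
def glue {n m : ℕ} (src tgt : Fin m → Fin n) (p : Fin m × I) : Fin n ⊕ (Fin m × I) :=
  open Classical in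
  if p.2 = 0 then Sum.inl (src p.1) else if p.2 = 1 then Sum.inl (tgt p.1) else Sum.inr p

/-- The topological space built from `m` disjoint copies of `[0,1]` by identifying those endpoints
that are attached to the same vertex. -/
def Space {n m : ℕ} (src tgt : Fin m → Fin n) : Type :=
  Quotient (Setoid.ker (glue src tgt))

/-- The quotient topology. -/
instance {n m : ℕ} (src tgt : Fin m → Fin n) : TopologicalSpace (Space src tgt) :=
  inferInstanceAs (TopologicalSpace (Quotient (Setoid.ker (glue src tgt))))

variable {n m : ℕ} {src tgt : Fin m → Fin n}

/-- The parametrization by `[0,1]` of the (closed) edge `e`. -/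
def edge (e : Fin m) (t : I) : Space src tgt :=
  Quotient.mk (Setoid.ker (glue src tgt)) (e, t)

/-- For `z = (x₁, y₁, …, xₘ, yₘ)`, the closed set made up of the arcs `[xₑ, yₑ] ∩ [0,1]` of the
edges `e`. It need not be connected; an arc with `yₑ < xₑ` is empty. -/
def arcs (z : Fin m → ℝ × ℝ) : Set (Space src tgt) :=
  ⋃ e, edge e '' {t : I | (z e).1 ≤ t ∧ (t : ℝ) ≤ (z e).2}

end Tangle

/-- The connected subsets of a space; the empty set is one of them. -/
abbrev ConnectedSubset (T : Type*) [TopologicalSpace T] : Type _ :=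
  {X : Set T // IsPreconnected X}

/-- A valuation assigns a non-negative real number to every connected subset. -/
abbrev TangleValuation (T : Type*) [TopologicalSpace T] : Type _ := ConnectedSubset T → ℝ≥0

namespace Tangle

/-- Monotone continuous valuations on a tangle: `ν ∅ = 0`, `ν` is monotone with respect to
inclusion of connected subsets, and the value of the closed set `arcs z` is a continuous function
of `z ∈ ℝ²ᵐ` on the set of those `z` for which `arcs z` is connected. -/
structure IsMonotoneContinuous {n m : ℕ} {src tgt : Fin m → Fin n}
    (ν : TangleValuation (Space src tgt)) : Prop where
  empty : ν ⟨∅, isPreconnected_empty⟩ = 0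
  mono : ∀ X Y : ConnectedSubset (Space src tgt), X.1 ⊆ Y.1 → ν X ≤ ν Y
  continuous : Continuous
    fun z : {z : Fin m → ℝ × ℝ // IsPreconnected (arcs z : Set (Space src tgt))} =>
      ν ⟨arcs z.1, z.2⟩

/-- The lips tangle. Its vertices are `a = 0`, `b = 1`, `c = 2`; it has two edges from `a` to `b`,
two edges from `b` to `c`, and one edge from `a` to `c`. -/
abbrev Lips : Type :=
  Space (n := 3) (m := 5) ![0, 0, 1, 1, 0] ![1, 1, 2, 2, 2]

end Tangle

end

/-! A sword at `τ` and a knife at `q` cut the lips into a left share L (`zL`), a middle share M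
(`zM`) and a right share R (`zR`). The sword sweeps the first edge from `b` to `a`, then from `a`
the second edge and finally the bar, the edge joining `a` to `c`. The knife sweeps the first edge
from `b` to `a`, from `a` the second edge, then the bar up to `c`, and from `c` the two edges back
towards `b`. While `τ` runs from 1 to 2 the sword rests and M hands its part of the second edge back
to R; otherwise M would fall apart when the sword takes `a`. So all shares remain connected.

Let F be the median over the agents of M - R, and G the least over the agents of max(M, R) - L. If F
= 0 and some agent accepts L while two agents accept waiting, then one agent can take L and the
other two disagree weakly about M and R (`exists_perm_of_median_eq_zero`). Since F increases with
`q`, a connectedness argument gives a common zero of F and G (`exists_common_zero'`), provided that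
G changes sign between `τ = 0` and `τ = 4` and G ≤ 0 wherever F ≤ 0 at `q = 4`. At `τ = 4` it
suffices that one agent weakly prefers the left lip with the bar to the right lip. At `q = 4` and `τ
≥ 1`, R lies in the second edge and L contains the first, so it suffices that two agents weakly
prefer the first edge to the second. The symmetries of the lips supply both preferences.

Two technical points remain. Closed shares overlap at their ends; `owner` makes them disjoint, and
`IsMonotoneContinuous.eq_of_exhausted` shows that this costs no value. Moreover L or M may be
degenerate at the common zero. A term `median - K * τ` added to G ensures that two agents then value
nothing that matters, and after a change of position the third agent simply chooses. -/

namespace Tangle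

/-! ### Connectedness of unions of arcs, and values of limits of arcs -/

section General

variable {n m : ℕ} {src tgt : Fin m → Fin n}

theorem edge_eq_edge {e e' : Fin m} {t t' : I} :
    (edge e t : Space src tgt) = edge e' t' ↔ glue src tgt (e, t) = glue src tgt (e', t') :=
  Quotient.eq

theorem continuous_edge (e : Fin m) : Continuous (edge e : I → Space src tgt) :=
  continuous_quotient_mk'.comp (by fun_prop : Continuous fun t : I => (e, t))

/-- The open cell of a point: a vertex, or an interior point of an edge. -/
noncomputable def cell : Space src tgt → Fin n ⊕ (Fin m × I) :=
  Quotient.lift (glue src tgt) fun _ _ h => h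

theorem cell_edge (e : Fin m) (t : I) : cell (edge e t : Space src tgt) = glue src tgt (e, t) := rfl

theorem exists_edge (p : Space src tgt) : ∃ e t, edge e t = p := by
  induction p using Quotient.inductionOn with
  | _ p => exact ⟨p.1, p.2, rfl⟩

theorem glue_zero (e : Fin m) : glue src tgt (e, 0) = Sum.inl (src e) := by simp [glue]

theorem glue_one (e : Fin m) : glue src tgt (e, 1) = Sum.inl (tgt e) := by simp [glue]

theorem glue_of_pos_lt {e : Fin m} {t : I} (h₀ : (0 : ℝ) < t) (h₁ : (t : ℝ) < 1) :
    glue src tgt (e, t) = Sum.inr (e, t) := by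
  have h0 : t ≠ 0 := by rintro rfl; simp at h₀
  have h1 : t ≠ 1 := by rintro rfl; simp at h₁
  simp [glue, h0, h1]

theorem unitInterval_cases (t : I) : t = 0 ∨ t = 1 ∨ ((0 : ℝ) < t ∧ (t : ℝ) < 1) := by
  rcases t.2.1.eq_or_lt with h | h
  · exact .inl (Subtype.ext h.symm)
  · rcases t.2.2.eq_or_lt with h' | h'
    · exact .inr (.inl (Subtype.ext h'))
    · exact .inr (.inr ⟨h, h'⟩)

/-- The arc `[x, y] ∩ [0, 1]` of the edge `e`, for `z e = (x, y)`. -/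
def arc (z : Fin m → ℝ × ℝ) (e : Fin m) : Set (Space src tgt) :=
  edge e '' {t : I | (z e).1 ≤ t ∧ (t : ℝ) ≤ (z e).2}

theorem mem_arcs {z : Fin m → ℝ × ℝ} {p : Space src tgt} :
    p ∈ arcs z ↔ ∃ e, ∃ t : I, ((z e).1 ≤ t ∧ (t : ℝ) ≤ (z e).2) ∧ edge e t = p := by
  simp [arcs, Set.mem_iUnion]

theorem isPreconnected_arc (z : Fin m → ℝ × ℝ) (e : Fin m) :
    IsPreconnected (arc z e : Set (Space src tgt)) := by
  refine IsPreconnected.image ?_ _ (continuous_edge e).continuousOn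
  refine Set.OrdConnected.isPreconnected ⟨fun a ha b hb c hc => ⟨ha.1.trans ?_, le_trans ?_ hb.2⟩⟩
  · exact_mod_cast hc.1
  · exact_mod_cast hc.2

/-- The arc of the edge `e` is empty. -/
def Void (z : Fin m → ℝ × ℝ) (e : Fin m) : Prop :=
  (z e).2 < (z e).1 ∨ (z e).2 < 0 ∨ 1 < (z e).1

theorem Void.not_mem {z : Fin m → ℝ × ℝ} {e : Fin m} (h : Void z e) {p : Space src tgt} :
    p ∉ arc z e := by
  rintro ⟨t, ⟨h1, h2⟩, -⟩
  have := t.2.1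
  have := t.2.2
  rcases h with h | h | h <;> linarith

/-- The arc of the edge `e` contains the vertex `v`. -/
def Touches (src tgt : Fin m → Fin n) (z : Fin m → ℝ × ℝ) (v : Fin n) (e : Fin m) : Prop :=
  (src e = v ∧ (z e).1 ≤ 0 ∧ 0 ≤ (z e).2) ∨ (tgt e = v ∧ (z e).1 ≤ 1 ∧ 1 ≤ (z e).2)

theorem Touches.exists_mem {z : Fin m → ℝ × ℝ} {v : Fin n} {e : Fin m}
    (h : Touches src tgt z v e) : ∃ p : Space src tgt, p ∈ arc z e ∧ cell p = Sum.inl v := by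
  rcases h with ⟨rfl, h1, h2⟩ | ⟨rfl, h1, h2⟩
  · exact ⟨edge e 0, ⟨0, ⟨by simpa using h1, by simpa using h2⟩, rfl⟩, glue_zero e⟩
  · exact ⟨edge e 1, ⟨1, ⟨by simpa using h1, by simpa using h2⟩, rfl⟩, glue_one e⟩

theorem cell_injective : Function.Injective (cell : Space src tgt → _) := by
  intro p q h
  obtain ⟨e, t, rfl⟩ := exists_edge p
  obtain ⟨e', t', rfl⟩ := exists_edge q
  exact edge_eq_edge.2 h

theorem Touches.inter_nonempty {z : Fin m → ℝ × ℝ} {v : Fin n} {e e' : Fin m}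
    (h : Touches src tgt z v e) (h' : Touches src tgt z v e') :
    ((arc z e : Set (Space src tgt)) ∩ arc z e').Nonempty := by
  obtain ⟨p, hp, hpv⟩ := h.exists_mem
  obtain ⟨p', hp', hpv'⟩ := h'.exists_mem
  obtain rfl : p = p' := cell_injective (hpv.trans hpv'.symm)
  exact ⟨p, hp, hp'⟩

theorem arc_subset_arcs (z : Fin m → ℝ × ℝ) (e : Fin m) :
    (arc z e : Set (Space src tgt)) ⊆ arcs z := subset_iUnion (fun e => arc z e) e

/-- Any two nonempty arcs meet at `v`. -/
theorem isPreconnected_arcs_of_star {z : Fin m → ℝ × ℝ} (v : Fin n)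
    (h : ∀ e, Void z e ∨ Touches src tgt z v e) :
    IsPreconnected (arcs z : Set (Space src tgt)) := by
  refine isPreconnected_of_forall_pair fun p hp q hq => ?_
  obtain ⟨e, he⟩ := mem_iUnion.1 hp
  obtain ⟨e', he'⟩ := mem_iUnion.1 hq
  have h1 := (h e).resolve_left fun hv => hv.not_mem he
  have h2 := (h e').resolve_left fun hv => hv.not_mem he'
  exact ⟨arc z e ∪ arc z e', union_subset (arc_subset_arcs z e) (arc_subset_arcs z e'),
    .inl he, .inr he',
    (isPreconnected_arc z e).union' (h1.inter_nonempty h2) (isPreconnected_arc z e')⟩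

/-- The arc on `f` reaches both `v` and `w`, so it meets every other nonempty arc. -/
theorem isPreconnected_arcs_of_hub {z : Fin m → ℝ × ℝ} (f : Fin m) (v w : Fin n)
    (hv : Touches src tgt z v f) (hw : Touches src tgt z w f)
    (h : ∀ e, Void z e ∨ Touches src tgt z v e ∨ Touches src tgt z w e) :
    IsPreconnected (arcs z : Set (Space src tgt)) := by
  have key : ∀ e, ∀ p ∈ (arc z e : Set (Space src tgt)),
      ((arc z e : Set (Space src tgt)) ∩ arc z f).Nonempty := by
    intro e p he
    rcases (h e).resolve_left fun hv => hv.not_mem he with h | h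
    · exact h.inter_nonempty hv
    · exact h.inter_nonempty hw
  refine isPreconnected_of_forall_pair fun p hp q hq => ?_
  obtain ⟨e, he⟩ := mem_iUnion.1 hp
  obtain ⟨e', he'⟩ := mem_iUnion.1 hq
  refine ⟨(arc z e ∪ arc z f) ∪ arc z e', union_subset (union_subset (arc_subset_arcs z e)
    (arc_subset_arcs z f)) (arc_subset_arcs z e'), .inl (.inl he), .inr he', ?_⟩
  refine ((isPreconnected_arc z e).union' (key e p he) (isPreconnected_arc z f)).union' ?_
    (isPreconnected_arc z e')
  obtain ⟨x, hx, hx'⟩ := key e' q he'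
  exact ⟨x, .inr hx', hx⟩

theorem isPreconnected_arcs_of_single {z : Fin m → ℝ × ℝ} (f : Fin m) (h : ∀ e, e ≠ f → Void z e) :
    IsPreconnected (arcs z : Set (Space src tgt)) := by
  have : (arcs z : Set (Space src tgt)) = arc z f := by
    refine (arc_subset_arcs z f).antisymm' fun p hp => ?_
    obtain ⟨e, he⟩ := mem_iUnion.1 hp
    by_cases hef : e = f
    · exact hef ▸ he
    · exact absurd he (h e hef).not_mem
  rw [this]
  exact isPreconnected_arc z f

theorem arcs_mono {z z' : Fin m → ℝ × ℝ}
    (h : ∀ e, Void z e ∨ (max 0 (z' e).1 ≤ max 0 (z e).1 ∧ min 1 (z e).2 ≤ min 1 (z' e).2)) :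
    (arcs z : Set (Space src tgt)) ⊆ arcs z' := by
  intro p hp
  obtain ⟨e, he⟩ := mem_iUnion.1 hp
  obtain ⟨h1, h2⟩ := (h e).resolve_left fun hv => hv.not_mem he
  obtain ⟨t, ⟨ht1, ht2⟩, rfl⟩ := he
  refine mem_arcs.2 ⟨e, t, ⟨?_, ?_⟩, rfl⟩
  · exact (le_max_right _ _).trans (h1.trans (max_le t.2.1 ht1))
  · exact le_trans (le_min t.2.2 ht2) (h2.trans (min_le_right _ _))

/-- `X` is exhausted from within by connected closed arcs that converge to `arcs z`. -/
def Exhausted (X : Set (Space src tgt)) (z : Fin m → ℝ × ℝ) : Prop :=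
  ∃ zf : ℝ → Fin m → ℝ × ℝ, Continuous zf ∧ zf 0 = z ∧
    (∀ δ > 0, IsPreconnected (arcs (zf δ) : Set (Space src tgt))) ∧
    (∀ δ > 0, arcs (zf δ) ⊆ X) ∧
    ∀ p ∈ X, ∃ δ₁ > 0, ∀ δ, 0 ≤ δ → δ ≤ δ₁ → p ∈ arcs (zf δ)

theorem Exhausted.subset {X : Set (Space src tgt)} {z : Fin m → ℝ × ℝ} (h : Exhausted X z) :
    X ⊆ arcs z := by
  obtain ⟨zf, -, rfl, -, -, h5⟩ := h
  intro p hp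
  obtain ⟨δ, hδ, h⟩ := h5 p hp
  exact h 0 le_rfl hδ.le

/-- For small `δ > 0` two given points lie in the same connected set of the exhaustion. -/
theorem Exhausted.isPreconnected {X : Set (Space src tgt)} {z : Fin m → ℝ × ℝ}
    (h : Exhausted X z) : IsPreconnected X := by
  obtain ⟨zf, -, rfl, h3, h4, h5⟩ := h
  refine isPreconnected_of_forall_pair fun p hp q hq => ?_
  obtain ⟨δ, hδ, h⟩ := h5 p hp
  obtain ⟨δ', hδ', h'⟩ := h5 q hq
  have h0 : 0 < min δ δ' := lt_min hδ hδ'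
  exact ⟨arcs (zf (min δ δ')), h4 _ h0, h _ h0.le (min_le_left _ _), h' _ h0.le (min_le_right _ _),
    h3 _ h0⟩

theorem IsMonotoneContinuous.tendsto_arcs {ν : TangleValuation (Space src tgt)}
    (hν : IsMonotoneContinuous ν) {zf : ℝ → Fin m → ℝ × ℝ} (hc : Continuous zf)
    (h : ∀ δ > 0, IsPreconnected (arcs (zf δ) : Set (Space src tgt)))
    (h₀ : IsPreconnected (arcs (zf 0) : Set (Space src tgt))) {c : ℝ≥0}
    (hle : ∀ δ (hδ : 0 < δ), ν ⟨arcs (zf δ), h δ hδ⟩ ≤ c) : ν ⟨arcs (zf 0), h₀⟩ ≤ c := by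
  have h' : ∀ δ : Ici (0 : ℝ), IsPreconnected (arcs (zf δ) : Set (Space src tgt)) := by
    rintro ⟨δ, hδ⟩
    rcases (mem_Ici.1 hδ).eq_or_lt with rfl | hδ
    · exact h₀
    · exact h δ hδ
  have hsub : Continuous fun δ : Ici (0 : ℝ) =>
      (⟨zf δ, h' δ⟩ : {z : Fin m → ℝ × ℝ // IsPreconnected (arcs z : Set (Space src tgt))}) :=
    (hc.comp continuous_subtype_val).subtype_mk _
  have hcont : Continuous fun δ : Ici (0 : ℝ) => ν ⟨arcs (zf δ), h' δ⟩ := hν.continuous.comp hsub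
  have hseq : Filter.Tendsto
      (fun k : ℕ => (⟨1 / ((k : ℝ) + 1), mem_Ici.2 (by positivity)⟩ : Ici (0 : ℝ)))
      Filter.atTop (nhds ⟨0, self_mem_Ici⟩) :=
    tendsto_subtype_rng.2 tendsto_one_div_add_atTop_nhds_zero_nat
  exact le_of_tendsto ((hcont.tendsto _).comp hseq)
    (Filter.Eventually.of_forall fun k => hle _ (by positivity))

/-- Monotonicity squeezes the value of `X` between the values of the exhausting arcs and that of
`arcs z`; continuity closes the gap. Hence it does not matter to whom the ends of a share belong. -/
theorem IsMonotoneContinuous.eq_of_exhausted {ν : TangleValuation (Space src tgt)}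
    (hν : IsMonotoneContinuous ν) {X : Set (Space src tgt)} {z : Fin m → ℝ × ℝ}
    (h : Exhausted X z) (hz : IsPreconnected (arcs z : Set (Space src tgt))) :
    ν ⟨X, h.isPreconnected⟩ = ν ⟨arcs z, hz⟩ := by
  refine le_antisymm (hν.mono _ _ h.subset) ?_
  have h' := h.isPreconnected
  obtain ⟨zf, hc, rfl, h3, h4, -⟩ := h
  exact hν.tendsto_arcs hc h3 hz fun δ hδ => hν.mono _ ⟨X, h'⟩ (h4 δ hδ)

/-- Shortening each arc by `δ` at both ends leaves the empty set, whose value is 0; let `δ` tend to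
0. -/
theorem IsMonotoneContinuous.eq_zero_of_degenerate {ν : TangleValuation (Space src tgt)}
    (hν : IsMonotoneContinuous ν) {z : Fin m → ℝ × ℝ} (h : ∀ e, Void z e ∨ (z e).2 ≤ (z e).1)
    (hz : IsPreconnected (arcs z : Set (Space src tgt))) : ν ⟨arcs z, hz⟩ = 0 := by
  have hempty : ∀ δ > (0 : ℝ),
      (arcs (fun e => ((z e).1 + δ, (z e).2 - δ)) : Set (Space src tgt)) = ∅ := by
    intro δ hδ
    refine iUnion_eq_empty.2 fun e => eq_empty_iff_forall_notMem.2 fun p =>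
      Void.not_mem (z := fun e => ((z e).1 + δ, (z e).2 - δ)) ?_
    rcases h e with (h | h | h) | h
    · exact .inl (by simp only; linarith)
    · exact .inr (.inl (by simp only; linarith))
    · exact .inr (.inr (by simp only; linarith))
    · exact .inl (by simp only; linarith)
  have hz0 : (fun e => ((z e).1 + 0, (z e).2 - 0)) = z := by simp
  have h₀ : IsPreconnected
      (arcs (fun e => ((z e).1 + 0, (z e).2 - 0)) : Set (Space src tgt)) := by rwa [hz0]
  have := hν.tendsto_arcs (zf := fun δ e => ((z e).1 + δ, (z e).2 - δ)) (by fun_prop)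
    (fun δ hδ => by rw [hempty δ hδ]; exact isPreconnected_empty) h₀ (c := 0) fun δ hδ => by
      rw [← hν.empty]
      exact hν.mono _ _ (hempty δ hδ).le
  simp only [add_zero, sub_zero] at this
  exact le_antisymm this zero_le

end General

end Tangle

/-! ### Common zeros of two functions on a rectangle -/

/-- If the zero set of `F` in the strip `[a, b] × [c, d]` crosses the strip (by monotonicity of `F`
in the second variable), then a function `G` that changes sign along it has a zero on it. -/
theorem exists_common_zero {a b c d : ℝ} (hab : a ≤ b) (hcd : c ≤ d) {F G : ℝ → ℝ → ℝ}
    (hF : Continuous fun p : ℝ × ℝ => F p.1 p.2) (hG : Continuous fun p : ℝ × ℝ => G p.1 p.2)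
    (hmono : ∀ t, Monotone (F t)) (hc : ∀ t ∈ Icc a b, F t c ≤ 0) (hd : ∀ t ∈ Icc a b, 0 ≤ F t d)
    (ha : ∃ q ∈ Icc c d, F a q = 0 ∧ 0 ≤ G a q) (hb : ∀ q ∈ Icc c d, F b q = 0 → G b q ≤ 0) :
    ∃ t ∈ Icc a b, ∃ q ∈ Icc c d, F t q = 0 ∧ G t q = 0 := by
  have hex : ∀ t ∈ Icc a b, ∃ q ∈ Icc c d, F t q = 0 := fun t ht =>
    intermediate_value_Icc hcd
      (f := F t) (hF.comp (by fun_prop : Continuous fun q : ℝ => (t, q))).continuousOn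
      ⟨hc t ht, hd t ht⟩
  have hclosed : ∀ S : Set (ℝ × ℝ), IsClosed S →
      IsClosed (Prod.fst '' ((Icc a b ×ˢ Icc c d) ∩ S)) := fun S hS =>
    (((isCompact_Icc.prod isCompact_Icc).inter_right hS).image continuous_fst).isClosed
  have hP := hclosed {p | F p.1 p.2 = 0 ∧ 0 ≤ G p.1 p.2}
    ((isClosed_eq hF continuous_const).inter (isClosed_le continuous_const hG))
  have hN := hclosed {p | F p.1 p.2 = 0 ∧ G p.1 p.2 ≤ 0}
    ((isClosed_eq hF continuous_const).inter (isClosed_le hG continuous_const))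
  -- The zeros of `F` with `G ≥ 0` and those with `G ≤ 0` project to two closed sets that cover the
  -- connected interval `[a, b]`, so some slice contains zeros of both kinds.
  obtain ⟨t, ht, ⟨⟨_, q₁⟩, ⟨⟨-, hq₁⟩, hF₁, hG₁⟩, rfl⟩, ⟨⟨_, q₂⟩, ⟨⟨-, hq₂⟩, hF₂, hG₂⟩, rfl⟩⟩ :=
    isPreconnected_closed_iff.1 (isPreconnected_Icc (a := a) (b := b)) _ _ hP hN
      (fun t ht => by
        obtain ⟨q, hq, h⟩ := hex t ht
        rcases le_total 0 (G t q) with h' | h'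
        · exact .inl ⟨(t, q), ⟨⟨ht, hq⟩, h, h'⟩, rfl⟩
        · exact .inr ⟨(t, q), ⟨⟨ht, hq⟩, h, h'⟩, rfl⟩)
      (by
        obtain ⟨q, hq, h, h'⟩ := ha
        exact ⟨a, left_mem_Icc.2 hab, (a, q), ⟨⟨left_mem_Icc.2 hab, hq⟩, h, h'⟩, rfl⟩)
      (by
        obtain ⟨q, hq, h⟩ := hex b (right_mem_Icc.2 hab)
        exact ⟨b, right_mem_Icc.2 hab, (b, q),
          ⟨⟨right_mem_Icc.2 hab, hq⟩, h, hb q hq h⟩, rfl⟩)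
  simp only at hF₁ hG₁ hF₂ hG₂ hq₁ hq₂ ht
  rename_i t
  have hGt : Continuous (G t) := hG.comp (by fun_prop : Continuous fun q : ℝ => (t, q))
  -- By monotonicity `F t` vanishes everywhere between its zeros `q₁` and `q₂`, so any zero of `G t`
  -- in between will do.
  obtain ⟨q, hq, hq0⟩ := (isPreconnected_uIcc (a := q₂) (b := q₁)).intermediate_value
    left_mem_uIcc right_mem_uIcc hGt.continuousOn ⟨hG₂, hG₁⟩
  refine ⟨t, ht, q, uIcc_subset_Icc hq₂ hq₁ hq, ?_, hq0⟩
  rcases le_total q₂ q₁ with h | h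
  · rw [uIcc_of_le h] at hq
    exact le_antisymm (hF₁ ▸ hmono t hq.2) (hF₂ ▸ hmono t hq.1)
  · rw [uIcc_of_ge h] at hq
    exact le_antisymm (hF₂ ▸ hmono t hq.2) (hF₁ ▸ hmono t hq.1)

/-- A variant of `exists_common_zero` where `F` need not reach `0` at the upper end of the strip,
provided that `G ≤ 0` where it does not. -/
theorem exists_common_zero' {a b c d : ℝ} (hab : a ≤ b) (hcd : c ≤ d) {F G : ℝ → ℝ → ℝ}
    (hF : Continuous fun p : ℝ × ℝ => F p.1 p.2) (hG : Continuous fun p : ℝ × ℝ => G p.1 p.2)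
    (hmono : ∀ t, Monotone (F t)) (hc : ∀ t ∈ Icc a b, F t c ≤ 0) (had : 0 ≤ F a d)
    (ha : ∀ q ∈ Icc c d, 0 ≤ G a q) (hb : ∀ q ∈ Icc c d, G b q ≤ 0)
    (hd : ∀ t ∈ Icc a b, F t d ≤ 0 → G t d ≤ 0) :
    ∃ t ∈ Icc a b, ∃ q ∈ Icc c d, F t q = 0 ∧ G t q = 0 := by
  have hFa : Continuous (F a) := hF.comp (by fun_prop : Continuous fun q : ℝ => (a, q))
  obtain ⟨q₀, hq₀, hFq₀⟩ := intermediate_value_Icc hcd hFa.continuousOn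
    ⟨hc a (left_mem_Icc.2 hab), had⟩
  have hFd : Continuous fun p : ℝ × ℝ => F p.1 (min p.2 d) :=
    hF.comp (by fun_prop : Continuous fun p : ℝ × ℝ => (p.1, min p.2 d))
  have hFd' : Continuous fun p : ℝ × ℝ => F p.1 d :=
    hF.comp (by fun_prop : Continuous fun p : ℝ × ℝ => (p.1, d))
  have hGd : Continuous fun p : ℝ × ℝ => G p.1 (min p.2 d) :=
    hG.comp (by fun_prop : Continuous fun p : ℝ × ℝ => (p.1, min p.2 d))
  -- The strip is extended by one unit, over which `F` grows by `|F t d|` and so becomes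
  -- nonnegative, while `G` decreases strictly.
  obtain ⟨t, ht, q, hq, h1, h2⟩ := exists_common_zero (a := a) (b := b) (c := c) (d := d + 1) hab
    (by linarith) (F := fun t q => F t (min q d) + max (q - d) 0 * |F t d|)
    (G := fun t q => G t (min q d) - max (q - d) 0)
    (hFd.add (by fun_prop)) (hGd.sub (by fun_prop))
    (fun t q q' h => add_le_add (hmono t (min_le_min_right _ h))
      (mul_le_mul_of_nonneg_right (max_le_max_right _ (by linarith)) (abs_nonneg _)))
    (fun t ht => by
      have : max (c - d) 0 = 0 := max_eq_right (by linarith)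
      simpa [hcd, this] using hc t ht)
    (fun t ht => by
      have : max (d + 1 - d) 0 = 1 := by simp
      simp only [this, one_mul, min_eq_right (by linarith : d ≤ d + 1)]
      linarith [neg_abs_le (F t d)])
    ⟨q₀, ⟨hq₀.1, hq₀.2.trans (by linarith)⟩, by
      have : max (q₀ - d) 0 = 0 := max_eq_right (by linarith [hq₀.2])
      simpa [hq₀.2, this, hFq₀] using ha q₀ hq₀⟩
    (fun q hq _ => by
      have := hb (min q d) ⟨le_min hq.1 hcd, min_le_right _ _⟩
      linarith [le_max_right (q - d) 0])
  rcases le_or_gt q d with h | h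
  · have h0 : max (q - d) 0 = 0 := max_eq_right (by linarith)
    simp only [min_eq_left h, h0, zero_mul, add_zero, sub_zero] at h1 h2
    exact ⟨t, ht, q, ⟨hq.1, h⟩, h1, h2⟩
  -- A common zero in the added strip would have `F t d ≤ 0` but `G t d = q - d > 0`, against `hd`.
  · have h0 : max (q - d) 0 = q - d := max_eq_left (by linarith)
    simp only [min_eq_right h.le, h0] at h1 h2
    have := hd t ht (by nlinarith [mul_nonneg (sub_nonneg.2 h.le) (abs_nonneg (F t d))])
    linarith

namespace Tangle

/-! ### Symmetries and the transport of envy-free partitions -/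

section Symmetry

variable {n m : ℕ} {src tgt : Fin m → Fin n}

/-- The map of tangles that sends the edge `e` to the edge `π e` by way of `r`. -/
noncomputable def relabel (π : Fin m → Fin m) (r : I → I)
    (h : ∀ p p', glue src tgt p = glue src tgt p' →
      glue src tgt (π p.1, r p.2) = glue src tgt (π p'.1, r p'.2)) :
    Space src tgt → Space src tgt :=
  Quotient.map (fun p => (π p.1, r p.2)) h

theorem continuous_relabel {π : Fin m → Fin m} {r : I → I} (hr : Continuous r)
    (h : ∀ p p', glue src tgt p = glue src tgt p' →
      glue src tgt (π p.1, r p.2) = glue src tgt (π p'.1, r p'.2)) :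
    Continuous (relabel π r h : Space src tgt → Space src tgt) :=
  Continuous.quotient_map' (s := Setoid.ker (glue src tgt)) (t := Setoid.ker (glue src tgt))
    (f := fun p => (π p.1, r p.2))
    (((continuous_of_discreteTopology (f := π)).comp continuous_fst).prodMk
      (hr.comp continuous_snd)) h

/-- A map of edges descends to the quotient once it is induced by some map `Φ` of cells. -/
theorem glue_comp {π : Fin m → Fin m} {r : I → I} {Φ : Fin n ⊕ (Fin m × I) → Fin n ⊕ (Fin m × I)}
    (hΦ : ∀ p, glue src tgt (π p.1, r p.2) = Φ (glue src tgt p)) (p p' : Fin m × I)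
    (h : glue src tgt p = glue src tgt p') :
    glue src tgt (π p.1, r p.2) = glue src tgt (π p'.1, r p'.2) := by
  rw [hΦ, hΦ, h]

/-- Connected envy-free partitions. -/
def HasEnvyFree {ι : Type*} {T : Type*} [TopologicalSpace T] (ν : ι → TangleValuation T) : Prop :=
  ∃ A : ι → ConnectedSubset T, (∀ i, (A i).1.Nonempty) ∧
    (∀ i j, i ≠ j → Disjoint (A i).1 (A j).1) ∧ (⋃ i, (A i).1) = Set.univ ∧
    ∀ i j, ν i (A j) ≤ ν i (A i)

/-- The valuation of the image under a continuous map. -/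
def pullback {T : Type*} [TopologicalSpace T] (φ : T → T) (hφ : Continuous φ)
    (ν : TangleValuation T) : TangleValuation T :=
  fun X => ν ⟨φ '' X.1, X.2.image φ hφ.continuousOn⟩

theorem HasEnvyFree.of_pullback {ι : Type*} {T : Type*} [TopologicalSpace T] {φ : T → T}
    (hφ : Continuous φ) (hb : Function.Bijective φ) {ν : ι → TangleValuation T}
    (h : HasEnvyFree fun i => pullback φ hφ (ν i)) : HasEnvyFree ν := by
  obtain ⟨A, h1, h2, h3, h4⟩ := h
  refine ⟨fun i => ⟨φ '' (A i).1, (A i).2.image φ hφ.continuousOn⟩, fun i => (h1 i).image φ,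
    fun i j hij => (disjoint_image_iff hb.1).2 (h2 i j hij), ?_, h4⟩
  simp only
  rw [← image_iUnion, h3, image_univ, hb.2.range_eq]

/-- `ψ` is the action of `φ` on the endpoints of arcs; its continuity transfers condition (2). -/
theorem IsMonotoneContinuous.pullback {φ : Space src tgt → Space src tgt} (hφ : Continuous φ)
    {ν : TangleValuation (Space src tgt)} (hν : IsMonotoneContinuous ν)
    (ψ : (Fin m → ℝ × ℝ) → Fin m → ℝ × ℝ) (hψ : Continuous ψ)
    (h : ∀ z, φ '' arcs z = arcs (ψ z)) : IsMonotoneContinuous (pullback φ hφ ν) where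
  empty := by
    rw [← hν.empty]
    unfold Tangle.pullback
    congr 2
    exact image_empty φ
  mono X Y hXY := hν.mono _ _ (image_mono hXY)
  continuous := by
    have hc : ∀ z : {z : Fin m → ℝ × ℝ // IsPreconnected (arcs z : Set (Space src tgt))},
        IsPreconnected (arcs (ψ z.1) : Set (Space src tgt)) := fun z =>
      h z.1 ▸ z.2.image φ hφ.continuousOn
    have hsub : Continuous fun z : {z : Fin m → ℝ × ℝ //
        IsPreconnected (arcs z : Set (Space src tgt))} =>
        (⟨ψ z.1, hc z⟩ : {z : Fin m → ℝ × ℝ // IsPreconnected (arcs z : Set (Space src tgt))}) :=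
      (hψ.comp continuous_subtype_val).subtype_mk _
    refine (hν.continuous.comp hsub).congr fun z => ?_
    simp only [Function.comp, Tangle.pullback, h]

end Symmetry

section LipsSymmetry

abbrev lipsSrc : Fin 5 → Fin 3 := ![0, 0, 1, 1, 0]
abbrev lipsTgt : Fin 5 → Fin 3 := ![1, 1, 2, 2, 2]

theorem relabel_image_arcs {n m : ℕ} {src tgt : Fin m → Fin n} {π : Fin m → Fin m} {r : I → I}
    (hπ : Function.Involutive π)
    (h : ∀ p p', glue src tgt p = glue src tgt p' →
      glue src tgt (π p.1, r p.2) = glue src tgt (π p'.1, r p'.2)) (z z' : Fin m → ℝ × ℝ)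
    (hz : ∀ e, r '' {t : I | (z e).1 ≤ t ∧ (t : ℝ) ≤ (z e).2} =
      {t : I | (z' (π e)).1 ≤ t ∧ (t : ℝ) ≤ (z' (π e)).2}) :
    relabel π r h '' arcs z = (arcs z' : Set (Space src tgt)) := by
  unfold arcs
  rw [image_iUnion, ← hπ.surjective.iUnion_comp
    fun e => (edge e '' {t : I | (z' e).1 ≤ t ∧ (t : ℝ) ≤ (z' e).2} : Set (Space src tgt))]
  refine iUnion_congr fun e => ?_
  rw [← hz, image_image, image_image]
  rfl

theorem relabel_bijective {n m : ℕ} {src tgt : Fin m → Fin n} {π : Fin m → Fin m} {r : I → I}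
    (hπ : Function.Involutive π) (hr : Function.Involutive r)
    (h : ∀ p p', glue src tgt p = glue src tgt p' →
      glue src tgt (π p.1, r p.2) = glue src tgt (π p'.1, r p'.2)) :
    Function.Bijective (relabel π r h : Space src tgt → Space src tgt) := by
  refine Function.Involutive.bijective fun p => ?_
  obtain ⟨e, t, rfl⟩ := exists_edge p
  change edge (π (π e)) (r (r t)) = edge e t
  rw [hπ, hr]

/-- Exchanging the two edges between `a` and `b`. -/
theorem glue_swap (p p' : Fin 5 × I) (h : glue lipsSrc lipsTgt p = glue lipsSrc lipsTgt p') :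
    glue lipsSrc lipsTgt (![1, 0, 2, 3, 4] p.1, id p.2) =
      glue lipsSrc lipsTgt (![1, 0, 2, 3, 4] p'.1, id p'.2) := by
  refine glue_comp (Φ := Sum.map id fun p => (![1, 0, 2, 3, 4] p.1, p.2)) (fun p => ?_) p p' h
  obtain ⟨e, t⟩ := p
  rcases unitInterval_cases t with rfl | rfl | ⟨h0, h1⟩
  · simp only [id, glue_zero]
    fin_cases e <;> rfl
  · simp only [id, glue_one]
    fin_cases e <;> rfl
  · simp only [id, glue_of_pos_lt h0 h1]
    rfl

/-- Exchanging the vertices `a` and `c`. -/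
theorem glue_mirror (p p' : Fin 5 × I) (h : glue lipsSrc lipsTgt p = glue lipsSrc lipsTgt p') :
    glue lipsSrc lipsTgt (![2, 3, 0, 1, 4] p.1, σ p.2) =
      glue lipsSrc lipsTgt (![2, 3, 0, 1, 4] p'.1, σ p'.2) := by
  refine glue_comp (Φ := Sum.map ![2, 1, 0] fun p => (![2, 3, 0, 1, 4] p.1, σ p.2))
    (fun p => ?_) p p' h
  obtain ⟨e, t⟩ := p
  rcases unitInterval_cases t with rfl | rfl | ⟨h0, h1⟩
  · simp only [unitInterval.symm_zero, glue_zero, glue_one]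
    fin_cases e <;> rfl
  · simp only [unitInterval.symm_one, glue_zero, glue_one]
    fin_cases e <;> rfl
  · rw [glue_of_pos_lt h0 h1, glue_of_pos_lt]
    · rfl
    · simpa using h1
    · simpa using h0

/-- The symmetry of the lips that exchanges the two edges between `a` and `b`. -/
noncomputable def swap : Lips → Lips := relabel ![1, 0, 2, 3, 4] id glue_swap

/-- The symmetry of the lips that exchanges the vertices `a` and `c`. -/
noncomputable def mirror : Lips → Lips := relabel ![2, 3, 0, 1, 4] σ glue_mirror

theorem swap_involutive : Function.Involutive (![1, 0, 2, 3, 4] : Fin 5 → Fin 5) := by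
  intro e; fin_cases e <;> rfl

theorem mirror_involutive : Function.Involutive (![2, 3, 0, 1, 4] : Fin 5 → Fin 5) := by
  intro e; fin_cases e <;> rfl

theorem continuous_swap : Continuous swap := continuous_relabel continuous_id _

theorem continuous_mirror : Continuous mirror :=
  continuous_relabel unitInterval.continuous_symm _

theorem bijective_swap : Function.Bijective swap :=
  relabel_bijective swap_involutive (fun _ => rfl) _

theorem bijective_mirror : Function.Bijective mirror :=
  relabel_bijective mirror_involutive unitInterval.symm_symm _

theorem swap_image_arcs (z : Fin 5 → ℝ × ℝ) :
    swap '' arcs z = arcs fun e => z (![1, 0, 2, 3, 4] e) :=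
  relabel_image_arcs swap_involutive _ _ _ fun e => by
    simp only [image_id]
    rw [swap_involutive e]

theorem mirror_image_arcs (z : Fin 5 → ℝ × ℝ) :
    mirror '' arcs z =
      arcs fun e => (1 - (z (![2, 3, 0, 1, 4] e)).2, 1 - (z (![2, 3, 0, 1, 4] e)).1) :=
  relabel_image_arcs mirror_involutive _ _ _ fun e => by
    simp only
    rw [mirror_involutive e]
    ext t
    constructor
    · rintro ⟨s, ⟨h1, h2⟩, rfl⟩
      simp only [mem_ofPred_eq, unitInterval.coe_symm_eq]
      constructor <;> linarith
    · rintro ⟨h1, h2⟩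
      refine ⟨σ t, ⟨?_, ?_⟩, unitInterval.symm_symm t⟩ <;>
        simp only [unitInterval.coe_symm_eq] <;> linarith

theorem IsMonotoneContinuous.pullback_swap {ν : TangleValuation Lips}
    (hν : IsMonotoneContinuous ν) : IsMonotoneContinuous (Tangle.pullback swap continuous_swap ν) :=
  hν.pullback continuous_swap _ (by fun_prop) swap_image_arcs

theorem IsMonotoneContinuous.pullback_mirror {ν : TangleValuation Lips}
    (hν : IsMonotoneContinuous ν) :
    IsMonotoneContinuous (Tangle.pullback mirror continuous_mirror ν) :=
  hν.pullback continuous_mirror _ (by fun_prop) mirror_image_arcs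

end LipsSymmetry

/-! ### The three closed shares cut by the sword and the knife -/

section Pieces

/-- The share on the left of the sword. -/
noncomputable def zL (τ : ℝ) : Fin 5 → ℝ × ℝ :=
  -- The sword moves on the first edge for `τ` in `[0, 1]`, rests on `[1, 2]`, and moves on the
  -- second edge and the bar on `[2, 3]` and `[3, 4]`. The pair `(1, 0)` is an empty arc.
  ![(max (1 - τ) 0, 1), (0, min (τ - 2) 1), (1, 0), (1, 0), (0, τ - 3)]

/-- The share between the sword and the knife. -/
noncomputable def zM (τ q : ℝ) : Fin 5 → ℝ × ℝ :=
  -- The knife takes one unit of `q` per edge, starting from `q = -1`. The bound `2 - τ` withdraws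
  -- this share from the second edge before the sword takes `a` at `τ = 2`.
  ![(-q, 1 - τ), (0, min (min q (2 - τ)) 1), (max (3 - q) 0, 1), (max (4 - q) 0, 1),
    (max (τ - 3) 0, q - 1)]

/-- The share on the right of the knife. -/
noncomputable def zR (τ q : ℝ) : Fin 5 → ℝ × ℝ :=
  ![(0, min (-q) (1 - τ)), (max (min q (2 - τ)) (τ - 2), 1), (0, 3 - q),
    (0, min (4 - q) 1), (max (max (q - 1) (τ - 3)) 0, 1)]

theorem forall_fin_five {P : Fin 5 → Prop} (h0 : P 0) (h1 : P 1) (h2 : P 2) (h3 : P 3) (h4 : P 4) :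
    ∀ e, P e := by
  intro e; fin_cases e <;> assumption

theorem void_or_touches_src {z : Fin 5 → ℝ × ℝ} (e : Fin 5) (h : (z e).1 ≤ 0) :
    Void z e ∨ Touches lipsSrc lipsTgt z (lipsSrc e) e := by
  rcases lt_or_ge (z e).2 0 with h' | h'
  · exact .inl (.inr (.inl h'))
  · exact .inr (.inl ⟨rfl, h, h'⟩)

theorem void_or_touches_tgt {z : Fin 5 → ℝ × ℝ} (e : Fin 5) (h : 1 ≤ (z e).2) :
    Void z e ∨ Touches lipsSrc lipsTgt z (lipsTgt e) e := by
  rcases lt_or_ge 1 (z e).1 with h' | h'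
  · exact .inl (.inr (.inr h'))
  · exact .inr (.inr ⟨rfl, h', h⟩)

theorem isPreconnected_star_a {z : Fin 5 → ℝ × ℝ} (h0 : (z 0).1 ≤ 0) (h1 : (z 1).1 ≤ 0)
    (h2 : Void z 2) (h3 : Void z 3) (h4 : (z 4).1 ≤ 0) : IsPreconnected (arcs z : Set Lips) :=
  isPreconnected_arcs_of_star 0 (forall_fin_five (void_or_touches_src 0 h0)
    (void_or_touches_src 1 h1) (.inl h2) (.inl h3) (void_or_touches_src 4 h4))

theorem isPreconnected_star_b {z : Fin 5 → ℝ × ℝ} (h0 : Void z 0) (h1 : 1 ≤ (z 1).2)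
    (h2 : (z 2).1 ≤ 0) (h3 : (z 3).1 ≤ 0) (h4 : Void z 4) : IsPreconnected (arcs z : Set Lips) :=
  isPreconnected_arcs_of_star 1 (forall_fin_five (.inl h0)
    (void_or_touches_tgt 1 h1) (void_or_touches_src 2 h2) (void_or_touches_src 3 h3) (.inl h4))

theorem isPreconnected_star_c {z : Fin 5 → ℝ × ℝ} (h0 : Void z 0) (h1 : Void z 1)
    (h2 : 1 ≤ (z 2).2) (h3 : 1 ≤ (z 3).2) (h4 : 1 ≤ (z 4).2) : IsPreconnected (arcs z : Set Lips) :=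
  isPreconnected_arcs_of_star 2 (forall_fin_five (.inl h0) (.inl h1)
    (void_or_touches_tgt 2 h2) (void_or_touches_tgt 3 h3) (void_or_touches_tgt 4 h4))

theorem isPreconnected_hub_ac {z : Fin 5 → ℝ × ℝ} (h0 : (z 0).1 ≤ 0) (h1 : (z 1).1 ≤ 0)
    (h2 : 1 ≤ (z 2).2) (h3 : 1 ≤ (z 3).2) (h4 : (z 4).1 ≤ 0) (h4' : 1 ≤ (z 4).2) :
    IsPreconnected (arcs z : Set Lips) :=
  isPreconnected_arcs_of_hub 4 0 2 (.inl ⟨rfl, h4, by linarith⟩) (.inr ⟨rfl, by linarith, h4'⟩)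
    (forall_fin_five ((void_or_touches_src 0 h0).imp_right .inl)
      ((void_or_touches_src 1 h1).imp_right .inl) ((void_or_touches_tgt 2 h2).imp_right .inr)
      ((void_or_touches_tgt 3 h3).imp_right .inr) ((void_or_touches_tgt 4 h4').imp_right .inr))

theorem isPreconnected_hub_bc {z : Fin 5 → ℝ × ℝ} (h0 : Void z 0) (h1 : 1 ≤ (z 1).2)
    (h2 : (z 2).1 ≤ 0) (h2' : 1 ≤ (z 2).2) (h3 : (z 3).1 ≤ 0) (h4 : 1 ≤ (z 4).2) :
    IsPreconnected (arcs z : Set Lips) :=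
  isPreconnected_arcs_of_hub 2 1 2 (.inl ⟨rfl, h2, by linarith⟩) (.inr ⟨rfl, by linarith, h2'⟩)
    (forall_fin_five (.inl h0) ((void_or_touches_tgt 1 h1).imp_right .inl)
      ((void_or_touches_src 2 h2).imp_right .inl) ((void_or_touches_src 3 h3).imp_right .inl)
      ((void_or_touches_tgt 4 h4).imp_right .inr))

theorem isPreconnected_edge_zero {z : Fin 5 → ℝ × ℝ} (h1 : Void z 1) (h2 : Void z 2)
    (h3 : Void z 3) (h4 : Void z 4) : IsPreconnected (arcs z : Set Lips) :=
  isPreconnected_arcs_of_single 0 (forall_fin_five (fun h => absurd rfl h) (fun _ => h1)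
    (fun _ => h2) (fun _ => h3) fun _ => h4)

theorem isPreconnected_edge_four {z : Fin 5 → ℝ × ℝ} (h0 : Void z 0) (h1 : Void z 1)
    (h2 : Void z 2) (h3 : Void z 3) : IsPreconnected (arcs z : Set Lips) :=
  isPreconnected_arcs_of_single 4 (forall_fin_five (fun _ => h0) (fun _ => h1) (fun _ => h2)
    (fun _ => h3) fun h => absurd rfl h)

theorem isPreconnected_zL (τ : ℝ) : IsPreconnected (arcs (zL τ) : Set Lips) := by
  have h2 : Void (zL τ) 2 := .inl zero_lt_one
  have h3 : Void (zL τ) 3 := .inl zero_lt_one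
  rcases lt_or_ge τ 2 with h | h
  · exact isPreconnected_edge_zero (.inl (min_lt_of_left_lt (show τ - 2 < 0 by linarith))) h2 h3
      (.inl (show τ - 3 < 0 by linarith))
  · exact isPreconnected_star_a (max_le (by linarith) le_rfl) le_rfl h2 h3 le_rfl

/-- What holds the share together is, in turn, a single edge, the vertex `a`, the whole bar, or the
vertex `c`. -/
theorem isPreconnected_zM (τ q : ℝ) : IsPreconnected (arcs (zM τ q) : Set Lips) := by
  rcases lt_or_ge q 2 with hq | hq
  · have h2 : Void (zM τ q) 2 := .inl (lt_max_of_lt_left (show 1 < 3 - q by linarith))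
    have h3 : Void (zM τ q) 3 := .inl (lt_max_of_lt_left (show 1 < 4 - q by linarith))
    rcases lt_or_ge q 0 with h0 | h0
    · exact isPreconnected_edge_zero
        (.inl (min_lt_of_left_lt (min_lt_of_left_lt h0))) h2 h3
        (.inl (lt_max_of_lt_right (show q - 1 < 0 by linarith)))
    rcases le_or_gt τ 2 with hτ | hτ
    · exact isPreconnected_star_a (show -q ≤ 0 by linarith) le_rfl h2 h3
        (max_le (by linarith) le_rfl)
    · exact isPreconnected_edge_four (.inr (.inl (show 1 - τ < 0 by linarith)))
        (.inl (min_lt_of_left_lt (min_lt_of_right_lt (show 2 - τ < 0 by linarith)))) h2 h3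
  · rcases le_or_gt τ 3 with hτ | hτ
    · exact isPreconnected_hub_ac (show -q ≤ 0 by linarith) le_rfl le_rfl le_rfl
        (max_le (by linarith) le_rfl) (show 1 ≤ q - 1 by linarith)
    · exact isPreconnected_star_c (.inr (.inl (show 1 - τ < 0 by linarith)))
        (.inl (min_lt_of_left_lt (min_lt_of_right_lt (show 2 - τ < 0 by linarith)))) le_rfl le_rfl
        (show 1 ≤ q - 1 by linarith)

/-- The bar is intact while the share still contains `a`. After that, an intact edge from `b` to `c`
joins the pieces as long as `q ≤ 2`, and then all pieces hang at `b`. -/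
theorem isPreconnected_zR (τ q : ℝ) : IsPreconnected (arcs (zR τ q) : Set Lips) := by
  by_cases h : q ≤ 0 ∧ τ ≤ 1
  · exact isPreconnected_hub_ac le_rfl
      (max_le (min_le_of_left_le h.1) (by linarith [h.2])) (show 1 ≤ 3 - q by linarith [h.1])
      (le_min (by linarith [h.1]) le_rfl)
      (max_le (max_le (by linarith [h.1]) (by linarith [h.2])) le_rfl) le_rfl
  have h0 : Void (zR τ q) 0 := by
    refine .inl ?_
    rcases not_and_or.1 h with h | h
    · exact min_lt_of_left_lt (show -q < 0 by linarith [not_le.1 h])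
    · exact min_lt_of_right_lt (show 1 - τ < 0 by linarith [not_le.1 h])
  rcases le_or_gt q 2 with hq | hq
  · exact isPreconnected_hub_bc h0 le_rfl le_rfl (show 1 ≤ 3 - q by linarith) le_rfl le_rfl
  · exact isPreconnected_star_b h0 le_rfl le_rfl le_rfl
      (.inl (lt_max_of_lt_left (lt_max_of_lt_left (show 1 < q - 1 by linarith))))

/-! ### Disjoint shares and their exhaustion by closed arcs -/

open Classical in
/-- The share that a vertex or an interior point of an edge belongs to when the sword and the knife
are at `τ` and `q`. -/
noncomputable def owner (τ q : ℝ) : Fin 3 ⊕ (Fin 5 × I) → Fin 3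
  | .inl v => ![if 2 ≤ τ then 0 else if 0 ≤ q then 1 else 2, 2, if 2 < q then 1 else 2] v
  | .inr (e, t) => ![if 1 - τ < t then 0 else if -q ≤ t then 1 else 2,
      if t < τ - 2 then 0 else if (t : ℝ) < min q (2 - τ) then 1 else 2,
      if 3 - q < t then 1 else 2,
      if 4 - q < t then 1 else 2,
      if t < τ - 3 then 0 else if t < q - 1 then 1 else 2] e

theorem owner_vertex_a_eq_zero {τ q : ℝ} :
    owner τ q (.inl 0) = 0 ↔ 2 ≤ τ := by
  simp only [owner, Matrix.cons_val]
  split_ifs <;> simp <;> grind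

theorem owner_vertex_a_eq_one {τ q : ℝ} :
    owner τ q (.inl 0) = 1 ↔ τ < 2 ∧ 0 ≤ q := by
  simp only [owner, Matrix.cons_val]
  split_ifs <;> simp <;> grind

theorem owner_vertex_a_eq_two {τ q : ℝ} :
    owner τ q (.inl 0) = 2 ↔ τ < 2 ∧ q < 0 := by
  simp only [owner, Matrix.cons_val]
  split_ifs <;> simp <;> grind

theorem owner_vertex_b_eq_zero {τ q : ℝ} :
    owner τ q (.inl 1) = 0 ↔ False := by
  simp [owner]

theorem owner_vertex_b_eq_one {τ q : ℝ} :
    owner τ q (.inl 1) = 1 ↔ False := by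
  simp [owner]

theorem owner_vertex_b_eq_two {τ q : ℝ} :
    owner τ q (.inl 1) = 2 ↔ True := by
  simp [owner]

theorem owner_vertex_c_eq_zero {τ q : ℝ} :
    owner τ q (.inl 2) = 0 ↔ False := by
  simp only [owner, Matrix.cons_val]
  split_ifs <;> simp

theorem owner_vertex_c_eq_one {τ q : ℝ} :
    owner τ q (.inl 2) = 1 ↔ 2 < q := by
  simp only [owner, Matrix.cons_val]
  split_ifs <;> simp <;> grind

theorem owner_vertex_c_eq_two {τ q : ℝ} :
    owner τ q (.inl 2) = 2 ↔ q ≤ 2 := by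
  simp only [owner, Matrix.cons_val]
  split_ifs <;> simp <;> grind

theorem owner_edge_zero_eq_zero {τ q : ℝ} {t : I} :
    owner τ q (.inr (0, t)) = 0 ↔ 1 - τ < t := by
  simp only [owner, Matrix.cons_val]
  split_ifs <;> simp <;> grind

theorem owner_edge_zero_eq_one {τ q : ℝ} {t : I} :
    owner τ q (.inr (0, t)) = 1 ↔ t ≤ 1 - τ ∧ -q ≤ t := by
  simp only [owner, Matrix.cons_val]
  split_ifs <;> simp <;> grind

theorem owner_edge_zero_eq_two {τ q : ℝ} {t : I} :
    owner τ q (.inr (0, t)) = 2 ↔ t ≤ 1 - τ ∧ t < -q := by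
  simp only [owner, Matrix.cons_val]
  split_ifs <;> simp <;> grind

theorem owner_edge_one_eq_zero {τ q : ℝ} {t : I} :
    owner τ q (.inr (1, t)) = 0 ↔ t < τ - 2 := by
  simp only [owner, Matrix.cons_val]
  split_ifs <;> simp <;> grind

theorem owner_edge_one_eq_one {τ q : ℝ} {t : I} :
    owner τ q (.inr (1, t)) = 1 ↔ τ - 2 ≤ t ∧ t < q ∧ t < 2 - τ := by
  simp only [owner, Matrix.cons_val]
  split_ifs <;> simp <;> grind

theorem owner_edge_one_eq_two {τ q : ℝ} {t : I} :
    owner τ q (.inr (1, t)) = 2 ↔ τ - 2 ≤ t ∧ (q ≤ t ∨ 2 - τ ≤ t) := by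
  simp only [owner, Matrix.cons_val]
  split_ifs <;> simp <;> grind

theorem owner_edge_two_eq_zero {τ q : ℝ} {t : I} :
    owner τ q (.inr (2, t)) = 0 ↔ False := by
  simp only [owner, Matrix.cons_val]
  split_ifs <;> simp

theorem owner_edge_two_eq_one {τ q : ℝ} {t : I} :
    owner τ q (.inr (2, t)) = 1 ↔ 3 - q < t := by
  simp only [owner, Matrix.cons_val]
  split_ifs <;> simp <;> grind

theorem owner_edge_two_eq_two {τ q : ℝ} {t : I} :
    owner τ q (.inr (2, t)) = 2 ↔ t ≤ 3 - q := by
  simp only [owner, Matrix.cons_val]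
  split_ifs <;> simp <;> grind

theorem owner_edge_three_eq_zero {τ q : ℝ} {t : I} :
    owner τ q (.inr (3, t)) = 0 ↔ False := by
  simp only [owner, Matrix.cons_val]
  split_ifs <;> simp

theorem owner_edge_three_eq_one {τ q : ℝ} {t : I} :
    owner τ q (.inr (3, t)) = 1 ↔ 4 - q < t := by
  simp only [owner, Matrix.cons_val]
  split_ifs <;> simp <;> grind

theorem owner_edge_three_eq_two {τ q : ℝ} {t : I} :
    owner τ q (.inr (3, t)) = 2 ↔ t ≤ 4 - q := by
  simp only [owner, Matrix.cons_val]
  split_ifs <;> simp <;> grind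

theorem owner_edge_four_eq_zero {τ q : ℝ} {t : I} :
    owner τ q (.inr (4, t)) = 0 ↔ t < τ - 3 := by
  simp only [owner, Matrix.cons_val]
  split_ifs <;> simp <;> grind

theorem owner_edge_four_eq_one {τ q : ℝ} {t : I} :
    owner τ q (.inr (4, t)) = 1 ↔ τ - 3 ≤ t ∧ t < q - 1 := by
  simp only [owner, Matrix.cons_val]
  split_ifs <;> simp <;> grind

theorem owner_edge_four_eq_two {τ q : ℝ} {t : I} :
    owner τ q (.inr (4, t)) = 2 ↔ τ - 3 ≤ t ∧ q - 1 ≤ t := by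
  simp only [owner, Matrix.cons_val]
  split_ifs <;> simp <;> grind

theorem owner_eq_iff {τ q : ℝ} :
    (owner τ q (.inl 0) = 0 ↔ 2 ≤ τ) ∧
    (owner τ q (.inl 0) = 1 ↔ τ < 2 ∧ 0 ≤ q) ∧
    (owner τ q (.inl 0) = 2 ↔ τ < 2 ∧ q < 0) ∧
    (owner τ q (.inl 1) = 0 ↔ False) ∧
    (owner τ q (.inl 1) = 1 ↔ False) ∧
    (owner τ q (.inl 1) = 2 ↔ True) ∧
    (owner τ q (.inl 2) = 0 ↔ False) ∧
    (owner τ q (.inl 2) = 1 ↔ 2 < q) ∧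
    (owner τ q (.inl 2) = 2 ↔ q ≤ 2) ∧
    (∀ t : I, owner τ q (.inr (0, t)) = 0 ↔ 1 - τ < t) ∧
    (∀ t : I, owner τ q (.inr (0, t)) = 1 ↔ t ≤ 1 - τ ∧ -q ≤ t) ∧
    (∀ t : I, owner τ q (.inr (0, t)) = 2 ↔ t ≤ 1 - τ ∧ t < -q) ∧
    (∀ t : I, owner τ q (.inr (1, t)) = 0 ↔ t < τ - 2) ∧
    (∀ t : I, owner τ q (.inr (1, t)) = 1 ↔ τ - 2 ≤ t ∧ t < q ∧ t < 2 - τ) ∧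
    (∀ t : I, owner τ q (.inr (1, t)) = 2 ↔ τ - 2 ≤ t ∧ (q ≤ t ∨ 2 - τ ≤ t)) ∧
    (∀ t : I, owner τ q (.inr (2, t)) = 0 ↔ False) ∧
    (∀ t : I, owner τ q (.inr (2, t)) = 1 ↔ 3 - q < t) ∧
    (∀ t : I, owner τ q (.inr (2, t)) = 2 ↔ t ≤ 3 - q) ∧
    (∀ t : I, owner τ q (.inr (3, t)) = 0 ↔ False) ∧
    (∀ t : I, owner τ q (.inr (3, t)) = 1 ↔ 4 - q < t) ∧
    (∀ t : I, owner τ q (.inr (3, t)) = 2 ↔ t ≤ 4 - q) ∧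
    (∀ t : I, owner τ q (.inr (4, t)) = 0 ↔ t < τ - 3) ∧
    (∀ t : I, owner τ q (.inr (4, t)) = 1 ↔ τ - 3 ≤ t ∧ t < q - 1) ∧
    (∀ t : I, owner τ q (.inr (4, t)) = 2 ↔ τ - 3 ≤ t ∧ q - 1 ≤ t) :=
  ⟨owner_vertex_a_eq_zero, owner_vertex_a_eq_one, owner_vertex_a_eq_two, owner_vertex_b_eq_zero,
    owner_vertex_b_eq_one, owner_vertex_b_eq_two, owner_vertex_c_eq_zero, owner_vertex_c_eq_one,
    owner_vertex_c_eq_two, fun _ => owner_edge_zero_eq_zero, fun _ => owner_edge_zero_eq_one,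
    fun _ => owner_edge_zero_eq_two, fun _ => owner_edge_one_eq_zero, fun _ =>
    owner_edge_one_eq_one, fun _ => owner_edge_one_eq_two, fun _ => owner_edge_two_eq_zero, fun
    _ => owner_edge_two_eq_one, fun _ => owner_edge_two_eq_two, fun _ =>
    owner_edge_three_eq_zero, fun _ => owner_edge_three_eq_one, fun _ =>
    owner_edge_three_eq_two, fun _ => owner_edge_four_eq_zero, fun _ => owner_edge_four_eq_one,
    fun _ => owner_edge_four_eq_two⟩

theorem arcs_subset_of_owner {z : Fin 5 → ℝ × ℝ} {o : Fin 3 ⊕ (Fin 5 × I) → Fin 3} {i : Fin 3}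
    (h0 : ∀ e, (z e).1 ≤ 0 → 0 ≤ (z e).2 → o (.inl (lipsSrc e)) = i)
    (h1 : ∀ e, (z e).1 ≤ 1 → 1 ≤ (z e).2 → o (.inl (lipsTgt e)) = i)
    (h : ∀ e t, ∀ ht : t ∈ I, 0 < t → t < 1 → (z e).1 ≤ t → t ≤ (z e).2 →
      o (.inr (e, ⟨t, ht⟩)) = i) :
    (arcs z : Set Lips) ⊆ {p | o (cell p) = i} := by
  intro p hp
  obtain ⟨e, t, ⟨ht, ht'⟩, rfl⟩ := mem_arcs.1 hp
  rw [mem_ofPred_eq, cell_edge]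
  rcases unitInterval_cases t with rfl | rfl | ⟨ht0, ht1⟩
  · rw [glue_zero]
    exact h0 e (by simpa using ht) (by simpa using ht')
  · rw [glue_one]
    exact h1 e (by simpa using ht) (by simpa using ht')
  · rw [glue_of_pos_lt ht0 ht1]
    exact h e t t.2 ht0 ht1 ht ht'

theorem mem_arcs_of_touches {z : Fin 5 → ℝ × ℝ} {v : Fin 3} {e : Fin 5}
    (h : Touches lipsSrc lipsTgt z v e) {p : Lips} (hp : cell p = Sum.inl v) : p ∈ arcs z := by
  obtain ⟨p', hp', h'⟩ := h.exists_mem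
  obtain rfl : p = p' := cell_injective (hp.trans h'.symm)
  exact arc_subset_arcs z e hp'

/-- This reduces exhaustion to inequalities between endpoints: `h0`, `h1`, `h` keep the shrunken
arcs inside the share, and `hv`, `he` say that each vertex and each interior point is eventually
caught. -/
theorem exhausted_of_owner {zf : ℝ → Fin 5 → ℝ × ℝ} {z : Fin 5 → ℝ × ℝ}
    {o : Fin 3 ⊕ (Fin 5 × I) → Fin 3} {i : Fin 3} (hc : Continuous zf) (hz : zf 0 = z)
    (hconn : ∀ δ > 0, IsPreconnected (arcs (zf δ) : Set Lips))
    (h0 : ∀ δ > 0, ∀ e, (zf δ e).1 ≤ 0 → 0 ≤ (zf δ e).2 → o (.inl (lipsSrc e)) = i)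
    (h1 : ∀ δ > 0, ∀ e, (zf δ e).1 ≤ 1 → 1 ≤ (zf δ e).2 → o (.inl (lipsTgt e)) = i)
    (h : ∀ δ > 0, ∀ e t, ∀ ht : t ∈ I, 0 < t → t < 1 → (zf δ e).1 ≤ t → t ≤ (zf δ e).2 →
      o (.inr (e, ⟨t, ht⟩)) = i)
    (hv : ∀ v, o (.inl v) = i → ∃ δ₁ > 0, ∀ δ, 0 ≤ δ → δ ≤ δ₁ →
      ∃ e, Touches lipsSrc lipsTgt (zf δ) v e)
    (he : ∀ e t, ∀ ht : t ∈ I, 0 < t → t < 1 → o (.inr (e, ⟨t, ht⟩)) = i →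
      (∃ δ₁ > 0, ∀ δ, 0 ≤ δ → δ ≤ δ₁ → (zf δ e).1 ≤ t) ∧
      ∃ δ₁ > 0, ∀ δ, 0 ≤ δ → δ ≤ δ₁ → t ≤ (zf δ e).2) :
    Exhausted {p : Lips | o (cell p) = i} z := by
  refine ⟨zf, hc, hz, hconn, fun δ hδ => arcs_subset_of_owner (h0 δ hδ) (h1 δ hδ) (h δ hδ),
    fun p hp => ?_⟩
  obtain ⟨e, t, rfl⟩ := exists_edge p
  have hvert : ∀ v, cell (edge e t : Lips) = Sum.inl v → ∃ δ₁ > 0, ∀ δ, 0 ≤ δ → δ ≤ δ₁ →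
      (edge e t : Lips) ∈ arcs (zf δ) := by
    intro v hpv
    rw [mem_ofPred_eq, hpv] at hp
    obtain ⟨δ, hδ, h⟩ := hv v hp
    refine ⟨δ, hδ, fun δ' h' h'' => ?_⟩
    obtain ⟨e, he⟩ := h δ' h' h''
    exact mem_arcs_of_touches he hpv
  rcases unitInterval_cases t with rfl | rfl | ⟨ht0, ht1⟩
  · exact hvert _ (glue_zero e)
  · exact hvert _ (glue_one e)
  · rw [mem_ofPred_eq, cell_edge, glue_of_pos_lt ht0 ht1] at hp
    obtain ⟨⟨δ, hδ, h⟩, ⟨δ', hδ', h'⟩⟩ := he e t t.2 ht0 ht1 hp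
    exact ⟨min δ δ', lt_min hδ hδ', fun x hx hx' => mem_arcs.2
      ⟨e, t, ⟨h x hx (hx'.trans (min_le_left _ _)), h' x hx (hx'.trans (min_le_right _ _))⟩, rfl⟩⟩

set_option maxHeartbeats 1000000 in
theorem exhausted_zL_of_two_le {τ q : ℝ} (hτ : 2 ≤ τ) (hτ' : τ ≤ 4) :
    Exhausted {p : Lips | owner τ q (cell p) = 0} (zL τ) := by
  -- From `τ = 2` on this share owns `a`, so the ends at `a` are kept; those at `b` and at the sword
  -- are excluded and recede by `δ`.
  refine exhausted_of_owner
    (zf := fun δ => ![(max (1 - τ) 0, 1 - δ), (0, min (τ - 2) 1 - δ), (1, 0), (1, 0),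
    (0, τ - 3 - δ)])
    ?_ ?_ ?_ ?_ ?_ ?_ ?_ ?_
  · refine continuous_pi (forall_fin_five ?_ ?_ ?_ ?_ ?_) <;> (dsimp; fun_prop)
  · simp [zL]
  · intro δ hδ
    refine isPreconnected_star_a ?_ ?_ ?_ ?_ ?_ <;>
      simp only [Void, Matrix.cons_val] <;> grind
  iterate 3
    · intro δ hδ
      refine forall_fin_five ?_ ?_ ?_ ?_ ?_ <;>
        simp only [owner_eq_iff, lipsSrc, lipsTgt, Matrix.cons_val] <;> grind
  · intro v hv
    have : v = 0 := by fin_cases v <;> simp_all [owner]; grind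
    subst this
    refine ⟨1, one_pos, fun δ _ _ => ⟨0, .inl ⟨rfl, ?_, ?_⟩⟩⟩ <;>
      simp only [Matrix.cons_val] <;> grind
  · refine forall_fin_five ?_ ?_ ?_ ?_ ?_ <;> intro t _ h0 h1 h
    · simp only [owner_eq_iff] at h
      refine ⟨⟨1, ?_, ?_⟩, 1 - t, ?_, ?_⟩ <;>
        (try simp only [Matrix.cons_val]) <;> grind
    · simp only [owner_eq_iff] at h
      refine ⟨⟨1, ?_, ?_⟩, min (τ - 2) 1 - t, ?_, ?_⟩ <;>
        (try simp only [Matrix.cons_val]) <;> grind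
    · simp only [owner_eq_iff] at h
    · simp only [owner_eq_iff] at h
    · simp only [owner_eq_iff] at h
      refine ⟨⟨1, ?_, ?_⟩, τ - 3 - t, ?_, ?_⟩ <;>
        (try simp only [Matrix.cons_val]) <;> grind

set_option maxHeartbeats 1000000 in
theorem exhausted_zL_of_lt_two {τ q : ℝ} (hτ : τ < 2) :
    Exhausted {p : Lips | owner τ q (cell p) = 0} (zL τ) := by
  refine exhausted_of_owner
    (zf := fun δ => ![(max (1 - τ) 0 + δ, 1 - δ), (0, min (τ - 2) 1 - δ), (1, 0), (1, 0),
    (0, τ - 3 - δ)])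
    ?_ ?_ ?_ ?_ ?_ ?_ ?_ ?_
  · refine continuous_pi (forall_fin_five ?_ ?_ ?_ ?_ ?_) <;> (dsimp; fun_prop)
  · simp [zL]
  · intro δ hδ
    refine isPreconnected_edge_zero ?_ ?_ ?_ ?_ <;>
      simp only [Void, Matrix.cons_val] <;> grind
  iterate 3
    · intro δ hδ
      refine forall_fin_five ?_ ?_ ?_ ?_ ?_ <;>
        simp only [owner_eq_iff, lipsSrc, lipsTgt, Matrix.cons_val] <;> grind
  · intro v hv
    exfalso
    fin_cases v <;> simp_all [owner] <;> grind
  · refine forall_fin_five ?_ ?_ ?_ ?_ ?_ <;> intro t _ h0 h1 h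
    · simp only [owner_eq_iff] at h
      refine ⟨⟨t - max (1 - τ) 0, ?_, ?_⟩, 1 - t, ?_, ?_⟩ <;>
        (try simp only [Matrix.cons_val]) <;> grind
    · simp only [owner_eq_iff] at h
      grind
    · simp only [owner_eq_iff] at h
    · simp only [owner_eq_iff] at h
    · simp only [owner_eq_iff] at h
      grind

set_option maxHeartbeats 1000000 in
theorem exhausted_zM_of_lt_two_of_le_two {τ q : ℝ} (hτ : 0 < τ) (hτ' : τ < 2)
    (hq : 0 < q ∨ τ - 1 < q) (hq' : q ≤ 2) :
    Exhausted {p : Lips | owner τ q (cell p) = 1} (zM τ q) := by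
  refine exhausted_of_owner
    (zf := fun δ => ![(-q, 1 - τ), (0, min (min q (2 - τ)) 1 - δ),
    (max (3 - q) 0 + δ, 1), (max (4 - q) 0 + δ, 1), (max (τ - 3) 0, q - 1 - δ)])
    ?_ ?_ ?_ ?_ ?_ ?_ ?_ ?_
  · refine continuous_pi (forall_fin_five ?_ ?_ ?_ ?_ ?_) <;> (dsimp; fun_prop)
  · simp [zM]
  · intro δ hδ
    rcases lt_or_ge q 0 with h | h
    · refine isPreconnected_edge_zero ?_ ?_ ?_ ?_ <;>
        simp only [Void, Matrix.cons_val] <;> grind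
    · refine isPreconnected_star_a ?_ ?_ ?_ ?_ ?_ <;>
      simp only [Void, Matrix.cons_val] <;> grind
  iterate 3
    · intro δ hδ
      refine forall_fin_five ?_ ?_ ?_ ?_ ?_ <;>
        simp only [owner_eq_iff, lipsSrc, lipsTgt, Matrix.cons_val] <;> grind
  · intro v hv
    have : v = 0 := by fin_cases v <;> simp_all [owner]
    subst this
    have hq0 : 0 ≤ q := by simp only [owner_eq_iff] at hv; grind
    -- The vertex `a` is reached along the first edge until the sword has consumed it, and along the
    -- second edge afterwards, where `hq` forces `q > 0`.
    rcases le_or_gt τ 1 with h1 | h1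
    · refine ⟨1, one_pos, fun δ _ _ => ⟨0, .inl ⟨rfl, ?_, ?_⟩⟩⟩ <;>
        simp only [Matrix.cons_val] <;> grind
    · refine ⟨min q (min (2 - τ) 1), by grind, fun δ _ _ => ⟨1, .inl ⟨rfl, ?_, ?_⟩⟩⟩ <;>
        simp only [Matrix.cons_val] <;> grind
  · refine forall_fin_five ?_ ?_ ?_ ?_ ?_ <;> intro t _ h0 h1 h
    · simp only [owner_eq_iff] at h
      refine ⟨⟨1, ?_, ?_⟩, 1, ?_, ?_⟩ <;>
        (try simp only [Matrix.cons_val]) <;> grind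
    · simp only [owner_eq_iff] at h
      refine ⟨⟨1, ?_, ?_⟩, min (min q (2 - τ)) 1 - t, ?_, ?_⟩ <;>
        (try simp only [Matrix.cons_val]) <;> grind
    · simp only [owner_eq_iff] at h
      grind
    · simp only [owner_eq_iff] at h
      grind
    · simp only [owner_eq_iff] at h
      refine ⟨⟨1, ?_, ?_⟩, q - 1 - t, ?_, ?_⟩ <;>
        (try simp only [Matrix.cons_val]) <;> grind

set_option maxHeartbeats 1000000 in
theorem exhausted_zM_of_lt_two_of_two_lt {τ q : ℝ} (hτ : 0 < τ) (hτ' : τ < 2) (hq : 2 < q) :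
    Exhausted {p : Lips | owner τ q (cell p) = 1} (zM τ q) := by
  refine exhausted_of_owner
    (zf := fun δ => ![(-q, 1 - τ), (0, min (min q (2 - τ)) 1 - δ),
    (max (3 - q) 0 + δ, 1), (max (4 - q) 0 + δ, 1), (max (τ - 3) 0, q - 1)])
    ?_ ?_ ?_ ?_ ?_ ?_ ?_ ?_
  · refine continuous_pi (forall_fin_five ?_ ?_ ?_ ?_ ?_) <;> (dsimp; fun_prop)
  · simp [zM]
  · intro δ hδ
    refine isPreconnected_hub_ac ?_ ?_ ?_ ?_ ?_ ?_ <;>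
      simp only [Matrix.cons_val] <;> grind
  iterate 3
    · intro δ hδ
      refine forall_fin_five ?_ ?_ ?_ ?_ ?_ <;>
        simp only [owner_eq_iff, lipsSrc, lipsTgt, Matrix.cons_val] <;> grind
  · intro v hv
    obtain rfl | rfl : v = 0 ∨ v = 2 := by fin_cases v <;> simp_all [owner]
    · refine ⟨1, one_pos, fun δ _ _ => ⟨4, .inl ⟨rfl, ?_, ?_⟩⟩⟩ <;>
        simp only [Matrix.cons_val] <;> grind
    · refine ⟨1, one_pos, fun δ _ _ => ⟨4, .inr ⟨rfl, ?_, ?_⟩⟩⟩ <;>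
        simp only [Matrix.cons_val] <;> grind
  · refine forall_fin_five ?_ ?_ ?_ ?_ ?_ <;> intro t _ h0 h1 h
    · simp only [owner_eq_iff] at h
      refine ⟨⟨1, ?_, ?_⟩, 1, ?_, ?_⟩ <;>
        (try simp only [Matrix.cons_val]) <;> grind
    · simp only [owner_eq_iff] at h
      refine ⟨⟨1, ?_, ?_⟩, min (min q (2 - τ)) 1 - t, ?_, ?_⟩ <;>
        (try simp only [Matrix.cons_val]) <;> grind
    · simp only [owner_eq_iff] at h
      refine ⟨⟨t - max (3 - q) 0, ?_, ?_⟩, 1, ?_, ?_⟩ <;>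
        (try simp only [Matrix.cons_val]) <;> grind
    · simp only [owner_eq_iff] at h
      refine ⟨⟨t - max (4 - q) 0, ?_, ?_⟩, 1, ?_, ?_⟩ <;>
        (try simp only [Matrix.cons_val]) <;> grind
    · simp only [owner_eq_iff] at h
      refine ⟨⟨1, ?_, ?_⟩, 1, ?_, ?_⟩ <;>
        (try simp only [Matrix.cons_val]) <;> grind

set_option maxHeartbeats 1000000 in
theorem exhausted_zM_of_two_le_of_le_two {τ q : ℝ} (hτ : 2 ≤ τ) (hq : q ≤ 2) :
    Exhausted {p : Lips | owner τ q (cell p) = 1} (zM τ q) := by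
  -- `max (τ - 3) δ` keeps the arc on the bar away from `a`, which belongs to the left share, but
  -- does not move its end at the sword once `τ > 3` and `δ` is small.
  refine exhausted_of_owner
    (zf := fun δ => ![(-q, 1 - τ), (0, min (min q (2 - τ)) 1 - δ),
    (max (3 - q) 0 + δ, 1), (max (4 - q) 0 + δ, 1), (max (τ - 3) δ, q - 1 - δ)])
    ?_ ?_ ?_ ?_ ?_ ?_ ?_ ?_
  · refine continuous_pi (forall_fin_five ?_ ?_ ?_ ?_ ?_) <;> (dsimp; fun_prop)
  · simp [zM]
  · intro δ hδ
    refine isPreconnected_edge_four ?_ ?_ ?_ ?_ <;>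
      simp only [Void, Matrix.cons_val] <;> grind
  iterate 3
    · intro δ hδ
      refine forall_fin_five ?_ ?_ ?_ ?_ ?_ <;>
        simp only [owner_eq_iff, lipsSrc, lipsTgt, Matrix.cons_val] <;> grind
  · intro v hv
    exfalso
    fin_cases v <;> simp_all [owner]
  · refine forall_fin_five ?_ ?_ ?_ ?_ ?_ <;> intro t _ h0 h1 h
    · simp only [owner_eq_iff] at h
      grind
    · simp only [owner_eq_iff] at h
      grind
    · simp only [owner_eq_iff] at h
      grind
    · simp only [owner_eq_iff] at h
      grind
    · simp only [owner_eq_iff] at h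
      refine ⟨⟨t, ?_, ?_⟩, q - 1 - t, ?_, ?_⟩ <;>
        (try simp only [Matrix.cons_val]) <;> grind

set_option maxHeartbeats 1000000 in
theorem exhausted_zM_of_two_le_of_two_lt {τ q : ℝ} (hτ : 2 ≤ τ) (hτ' : τ ≤ 4) (hq : 2 < q) :
    Exhausted {p : Lips | owner τ q (cell p) = 1} (zM τ q) := by
  refine exhausted_of_owner
    (zf := fun δ => ![(-q, 1 - τ), (0, min (min q (2 - τ)) 1 - δ),
    (max (3 - q) 0 + δ, 1), (max (4 - q) 0 + δ, 1), (max (τ - 3) δ, q - 1)])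
    ?_ ?_ ?_ ?_ ?_ ?_ ?_ ?_
  · refine continuous_pi (forall_fin_five ?_ ?_ ?_ ?_ ?_) <;> (dsimp; fun_prop)
  · simp [zM]
  · intro δ hδ
    refine isPreconnected_star_c ?_ ?_ ?_ ?_ ?_ <;>
      simp only [Void, Matrix.cons_val] <;> grind
  iterate 3
    · intro δ hδ
      refine forall_fin_five ?_ ?_ ?_ ?_ ?_ <;>
        simp only [owner_eq_iff, lipsSrc, lipsTgt, Matrix.cons_val] <;> grind
  · intro v hv
    have : v = 2 := by fin_cases v <;> simp_all [owner]
    subst this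
    refine ⟨1, one_pos, fun δ _ _ => ⟨4, .inr ⟨rfl, ?_, ?_⟩⟩⟩ <;>
      simp only [Matrix.cons_val] <;> grind
  · refine forall_fin_five ?_ ?_ ?_ ?_ ?_ <;> intro t _ h0 h1 h
    · simp only [owner_eq_iff] at h
      grind
    · simp only [owner_eq_iff] at h
      grind
    · simp only [owner_eq_iff] at h
      refine ⟨⟨t - max (3 - q) 0, ?_, ?_⟩, 1, ?_, ?_⟩ <;>
        (try simp only [Matrix.cons_val]) <;> grind
    · simp only [owner_eq_iff] at h
      refine ⟨⟨t - max (4 - q) 0, ?_, ?_⟩, 1, ?_, ?_⟩ <;>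
        (try simp only [Matrix.cons_val]) <;> grind
    · simp only [owner_eq_iff] at h
      refine ⟨⟨t, ?_, ?_⟩, 1, ?_, ?_⟩ <;>
        (try simp only [Matrix.cons_val]) <;> grind

set_option maxHeartbeats 1000000 in
theorem exhausted_zR_of_neg {τ q : ℝ} (hq : τ - 1 < q) (hq' : q < 0) :
    Exhausted {p : Lips | owner τ q (cell p) = 2} (zR τ q) := by
  refine exhausted_of_owner
    (zf := fun δ => ![(0, min (-q) (1 - τ) - δ), (max (min q (2 - τ)) (τ - 2), 1), (0, 3 - q),
    (0, min (4 - q) 1), (max (max (q - 1) (τ - 3)) 0, 1)])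
    ?_ ?_ ?_ ?_ ?_ ?_ ?_ ?_
  · refine continuous_pi (forall_fin_five ?_ ?_ ?_ ?_ ?_) <;> (dsimp; fun_prop)
  · simp [zR]
  · intro δ hδ
    refine isPreconnected_hub_ac ?_ ?_ ?_ ?_ ?_ ?_ <;>
      simp only [Matrix.cons_val] <;> grind
  iterate 3
    · intro δ hδ
      refine forall_fin_five ?_ ?_ ?_ ?_ ?_ <;>
        simp only [owner_eq_iff, lipsSrc, lipsTgt, Matrix.cons_val] <;> grind
  · intro v hv
    refine ⟨1, one_pos, fun δ _ _ => ?_⟩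
    fin_cases v
    · refine ⟨4, .inl ⟨rfl, ?_, ?_⟩⟩ <;> simp only [Matrix.cons_val] <;> grind
    · refine ⟨2, .inl ⟨rfl, ?_, ?_⟩⟩ <;> simp only [Matrix.cons_val] <;> grind
    · refine ⟨4, .inr ⟨rfl, ?_, ?_⟩⟩ <;> simp only [Matrix.cons_val] <;> grind
  · refine forall_fin_five ?_ ?_ ?_ ?_ ?_ <;> intro t _ h0 h1 h
    · simp only [owner_eq_iff] at h
      refine ⟨⟨1, ?_, ?_⟩, min (-q) (1 - τ) - t, ?_, ?_⟩ <;>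
        (try simp only [Matrix.cons_val]) <;> grind
    · simp only [owner_eq_iff] at h
      refine ⟨⟨1, ?_, ?_⟩, 1, ?_, ?_⟩ <;>
        (try simp only [Matrix.cons_val]) <;> grind
    · simp only [owner_eq_iff] at h
      refine ⟨⟨1, ?_, ?_⟩, 1, ?_, ?_⟩ <;>
        (try simp only [Matrix.cons_val]) <;> grind
    · simp only [owner_eq_iff] at h
      refine ⟨⟨1, ?_, ?_⟩, 1, ?_, ?_⟩ <;>
        (try simp only [Matrix.cons_val]) <;> grind
    · simp only [owner_eq_iff] at h
      refine ⟨⟨1, ?_, ?_⟩, 1, ?_, ?_⟩ <;>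
        (try simp only [Matrix.cons_val]) <;> grind

set_option maxHeartbeats 1000000 in
theorem exhausted_zR_of_le_two {τ q : ℝ} (hq : 0 ≤ q) (hq' : q ≤ 2) :
    Exhausted {p : Lips | owner τ q (cell p) = 2} (zR τ q) := by
  refine exhausted_of_owner
    (zf := fun δ => ![(0, min (-q) (1 - τ) - δ), (max (max (min q (2 - τ)) (τ - 2)) δ, 1),
      (0, 3 - q), (0, min (4 - q) 1), (max (max (q - 1) (τ - 3)) δ, 1)])
    ?_ ?_ ?_ ?_ ?_ ?_ ?_ ?_
  · refine continuous_pi (forall_fin_five ?_ ?_ ?_ ?_ ?_) <;> (dsimp; fun_prop)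
  · simp [zR]
    grind
  · intro δ hδ
    refine isPreconnected_hub_bc ?_ ?_ ?_ ?_ ?_ ?_ <;>
      simp only [Void, Matrix.cons_val] <;> grind
  iterate 3
    · intro δ hδ
      refine forall_fin_five ?_ ?_ ?_ ?_ ?_ <;>
        simp only [owner_eq_iff, lipsSrc, lipsTgt, Matrix.cons_val] <;> grind
  · intro v hv
    obtain rfl | rfl : v = 1 ∨ v = 2 := by fin_cases v <;> simp_all [owner]; grind
    · refine ⟨1, one_pos, fun δ _ _ => ⟨2, .inl ⟨rfl, ?_, ?_⟩⟩⟩ <;>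
        simp only [Matrix.cons_val] <;> grind
    · refine ⟨1, one_pos, fun δ _ _ => ⟨2, .inr ⟨rfl, ?_, ?_⟩⟩⟩ <;>
        simp only [Matrix.cons_val] <;> grind
  · refine forall_fin_five ?_ ?_ ?_ ?_ ?_ <;> intro t _ h0 h1 h
    · simp only [owner_eq_iff] at h
      grind
    · simp only [owner_eq_iff] at h
      refine ⟨⟨t, ?_, ?_⟩, 1, ?_, ?_⟩ <;>
        (try simp only [Matrix.cons_val]) <;> grind
    · simp only [owner_eq_iff] at h
      refine ⟨⟨1, ?_, ?_⟩, 1, ?_, ?_⟩ <;>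
        (try simp only [Matrix.cons_val]) <;> grind
    · simp only [owner_eq_iff] at h
      refine ⟨⟨1, ?_, ?_⟩, 1, ?_, ?_⟩ <;>
        (try simp only [Matrix.cons_val]) <;> grind
    · simp only [owner_eq_iff] at h
      refine ⟨⟨t, ?_, ?_⟩, 1, ?_, ?_⟩ <;>
        (try simp only [Matrix.cons_val]) <;> grind

set_option maxHeartbeats 1000000 in
theorem exhausted_zR_of_two_lt {τ q : ℝ} (hq : 2 < q) (hq' : q ≤ 4) :
    Exhausted {p : Lips | owner τ q (cell p) = 2} (zR τ q) := by
  -- For `q > 2` the vertex `c` is lost; since `4 - q` may still be at least 1, the last edge is cut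
  -- at `1 - δ`.
  refine exhausted_of_owner
    (zf := fun δ => ![(0, min (-q) (1 - τ) - δ), (max (max (min q (2 - τ)) (τ - 2)) δ, 1),
      (0, 3 - q), (0, min (4 - q) (1 - δ)), (max (max (q - 1) (τ - 3)) δ, 1)])
    ?_ ?_ ?_ ?_ ?_ ?_ ?_ ?_
  · refine continuous_pi (forall_fin_five ?_ ?_ ?_ ?_ ?_) <;> (dsimp; fun_prop)
  · simp [zR]
    grind
  · intro δ hδ
    refine isPreconnected_star_b ?_ ?_ ?_ ?_ ?_ <;>
      simp only [Void, Matrix.cons_val] <;> grind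
  iterate 3
    · intro δ hδ
      refine forall_fin_five ?_ ?_ ?_ ?_ ?_ <;>
        simp only [owner_eq_iff, lipsSrc, lipsTgt, Matrix.cons_val] <;> grind
  · intro v hv
    have : v = 1 := by fin_cases v <;> simp_all [owner]; grind
    subst this
    refine ⟨1, one_pos, fun δ _ _ => ⟨3, .inl ⟨rfl, ?_, ?_⟩⟩⟩ <;>
      simp only [Matrix.cons_val] <;> grind
  · refine forall_fin_five ?_ ?_ ?_ ?_ ?_ <;> intro t _ h0 h1 h
    · simp only [owner_eq_iff] at h
      grind
    · simp only [owner_eq_iff] at h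
      refine ⟨⟨t, ?_, ?_⟩, 1, ?_, ?_⟩ <;>
        (try simp only [Matrix.cons_val]) <;> grind
    · simp only [owner_eq_iff] at h
      refine ⟨⟨1, ?_, ?_⟩, 1, ?_, ?_⟩ <;>
        (try simp only [Matrix.cons_val]) <;> grind
    · simp only [owner_eq_iff] at h
      refine ⟨⟨1, ?_, ?_⟩, 1 - t, ?_, ?_⟩ <;>
        (try simp only [Matrix.cons_val]) <;> grind
    · simp only [owner_eq_iff] at h
      grind

end Pieces

/-! ### Proper positions, and the values of the shares -/

section Partition

/-- The positions of the sword and the knife where all three shares are nondegenerate. -/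
def Proper (τ q : ℝ) : Prop :=
  0 < τ ∧ τ ≤ 4 ∧ q ≤ 4 ∧ ((τ < 2 ∧ (0 < q ∨ τ - 1 < q)) ∨ (2 ≤ τ ∧ 1 < q ∧ τ - 2 < q))

theorem Proper.exhausted_zL {τ q : ℝ} (h : Proper τ q) :
    Exhausted {p : Lips | owner τ q (cell p) = 0} (zL τ) := by
  rcases lt_or_ge τ 2 with h' | h'
  · exact exhausted_zL_of_lt_two h'
  · exact exhausted_zL_of_two_le h' h.2.1

theorem Proper.exhausted_zM {τ q : ℝ} (h : Proper τ q) :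
    Exhausted {p : Lips | owner τ q (cell p) = 1} (zM τ q) := by
  obtain ⟨h1, h2, h3, ⟨h4, h5⟩ | ⟨h4, h5, h6⟩⟩ := h <;> rcases le_or_gt q 2 with h' | h'
  · exact exhausted_zM_of_lt_two_of_le_two h1 h4 h5 h'
  · exact exhausted_zM_of_lt_two_of_two_lt h1 h4 h'
  · exact exhausted_zM_of_two_le_of_le_two h4 h'
  · exact exhausted_zM_of_two_le_of_two_lt h4 h2 h'

theorem Proper.exhausted_zR {τ q : ℝ} (h : Proper τ q) :
    Exhausted {p : Lips | owner τ q (cell p) = 2} (zR τ q) := by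
  obtain ⟨h1, h2, h3, h4⟩ := h
  rcases lt_or_ge q 0 with h' | h'
  · exact exhausted_zR_of_neg (by grind) h'
  rcases le_or_gt q 2 with h'' | h''
  · exact exhausted_zR_of_le_two h' h''
  · exact exhausted_zR_of_two_lt h'' h3

theorem exists_of_owner {o : Fin 3 ⊕ (Fin 5 × I) → Fin 3} {i : Fin 3} (e : Fin 5) {t : ℝ}
    (h0 : 0 < t) (h1 : t < 1) (h : ∀ ht : t ∈ I, o (.inr (e, ⟨t, ht⟩)) = i) :
    {p : Lips | o (cell p) = i}.Nonempty :=
  ⟨edge e ⟨t, h0.le, h1.le⟩, by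
    rw [mem_ofPred_eq, cell_edge, glue_of_pos_lt (by exact h0) (by exact h1)]; exact h _⟩

theorem exists_of_owner_src {o : Fin 3 ⊕ (Fin 5 × I) → Fin 3} {i : Fin 3} (e : Fin 5)
    (h : o (.inl (lipsSrc e)) = i) : {p : Lips | o (cell p) = i}.Nonempty :=
  ⟨edge e 0, by rw [mem_ofPred_eq, cell_edge, glue_zero]; exact h⟩

theorem exists_of_owner_tgt {o : Fin 3 ⊕ (Fin 5 × I) → Fin 3} {i : Fin 3} (e : Fin 5)
    (h : o (.inl (lipsTgt e)) = i) : {p : Lips | o (cell p) = i}.Nonempty :=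
  ⟨edge e 1, by rw [mem_ofPred_eq, cell_edge, glue_one]; exact h⟩

theorem Proper.nonempty {τ q : ℝ} (h : Proper τ q) (i : Fin 3) :
    {p : Lips | owner τ q (cell p) = i}.Nonempty := by
  obtain ⟨h1, h2, h3, h4⟩ := h
  fin_cases i
  · rcases lt_or_ge τ 2 with h' | h'
    · exact exists_of_owner 0 (t := 1 - τ / 2) (by linarith) (by linarith)
        fun _ => owner_edge_zero_eq_zero.2 (by dsimp only; linarith)
    · exact exists_of_owner_src 0 (owner_vertex_a_eq_zero.2 h')
  · rcases h4 with ⟨h4, h5⟩ | ⟨h4, h5, h6⟩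
    · rcases lt_or_ge q 0 with h' | h'
      · exact exists_of_owner 0 (t := -q) (by linarith) (by grind)
          fun _ => owner_edge_zero_eq_one.2 ⟨by dsimp only; grind, le_rfl⟩
      · exact exists_of_owner_src 0 (owner_vertex_a_eq_one.2 ⟨h4, h'⟩)
    · rcases le_or_gt q 2 with h' | h'
      · exact exists_of_owner 4 (t := (max (τ - 3) 0 + (q - 1)) / 2) (by grind) (by grind)
          fun _ => owner_edge_four_eq_one.2 ⟨by dsimp only; grind, by dsimp only; grind⟩
      · exact exists_of_owner_tgt 2 (owner_vertex_c_eq_one.2 h')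
  · exact exists_of_owner_tgt 0 (owner_vertex_b_eq_two.2 trivial)

/-- The closed shares: left of the sword, between the sword and the knife, right of the knife. -/
noncomputable def shares (τ q : ℝ) : Fin 3 → Fin 5 → ℝ × ℝ := ![zL τ, zM τ q, zR τ q]

theorem isPreconnected_shares (τ q : ℝ) (i : Fin 3) :
    IsPreconnected (arcs (shares τ q i) : Set Lips) := by
  fin_cases i
  · exact isPreconnected_zL τ
  · exact isPreconnected_zM τ q
  · exact isPreconnected_zR τ q

theorem Proper.exhausted {τ q : ℝ} (h : Proper τ q) (i : Fin 3) :
    Exhausted {p : Lips | owner τ q (cell p) = i} (shares τ q i) := by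
  fin_cases i
  · exact h.exhausted_zL
  · exact h.exhausted_zM
  · exact h.exhausted_zR

/-- The value of a closed share. -/
noncomputable def value (ν : TangleValuation Lips) (i : Fin 3) (τ q : ℝ) : ℝ :=
  ν ⟨arcs (shares τ q i), isPreconnected_shares τ q i⟩

theorem value_nonneg (ν : TangleValuation Lips) (i : Fin 3) (τ q : ℝ) : 0 ≤ value ν i τ q :=
  NNReal.coe_nonneg _

variable {ν : Fin 3 → TangleValuation Lips}

/-- Closed and disjoint shares have equal values, so the choice may be made among closed ones. -/
theorem Proper.hasEnvyFree (hν : ∀ a, IsMonotoneContinuous (ν a)) {τ q : ℝ} (h : Proper τ q)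
    (s : Equiv.Perm (Fin 3)) (hs : ∀ a i, value (ν a) i τ q ≤ value (ν a) (s a) τ q) :
    HasEnvyFree ν := by
  refine ⟨fun a => ⟨{p | owner τ q (cell p) = s a}, (h.exhausted _).isPreconnected⟩,
    fun a => h.nonempty _, fun a b hab => ?_, ?_, fun a b => ?_⟩
  · refine disjoint_left.2 fun p hp hp' => hab (s.injective ?_)
    exact Eq.trans (Eq.symm hp) hp'
  · exact eq_univ_of_forall fun p => mem_iUnion.2 ⟨s.symm (owner τ q (cell p)), by simp⟩
  · rw [(hν a).eq_of_exhausted (h.exhausted _) (isPreconnected_shares τ q _),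
      (hν a).eq_of_exhausted (h.exhausted _) (isPreconnected_shares τ q _)]
    exact_mod_cast hs a (s b)

/-- If two agents do not value any of the three shares, then the third one may choose. -/
theorem Proper.hasEnvyFree_of_eq_zero (hν : ∀ a, IsMonotoneContinuous (ν a)) {τ q : ℝ}
    (h : Proper τ q) {a b : Fin 3} (hab : a ≠ b) (ha : ∀ i, value (ν a) i τ q ≤ 0)
    (hb : ∀ i, value (ν b) i τ q ≤ 0) : HasEnvyFree ν := by
  obtain ⟨c, hc⟩ : ∃ c : Fin 3, ∀ d, d = a ∨ d = b ∨ d = c :=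
    (by decide : ∀ a b : Fin 3, a ≠ b → ∃ c : Fin 3, ∀ d, d = a ∨ d = b ∨ d = c) a b hab
  obtain ⟨i, hi⟩ := Finite.exists_max fun i => value (ν c) i τ q
  refine h.hasEnvyFree hν (Equiv.swap c i) fun d j => ?_
  by_cases hdc : d = c
  · subst hdc
    rw [Equiv.swap_apply_left]
    exact hi j
  · rcases hc d with rfl | rfl | hd
    · exact (ha j).trans (value_nonneg _ _ _ _)
    · exact (hb j).trans (value_nonneg _ _ _ _)
    · exact absurd hd hdc

theorem value_le_value {ν : TangleValuation Lips} (hν : IsMonotoneContinuous ν) {i j : Fin 3}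
    {τ q τ' q' : ℝ} (h : (arcs (shares τ q i) : Set Lips) ⊆ arcs (shares τ' q' j)) :
    value ν i τ q ≤ value ν j τ' q' :=
  NNReal.coe_le_coe.2 (hν.mono _ _ h)

theorem continuous_value {ν : TangleValuation Lips} (hν : IsMonotoneContinuous ν) (i : Fin 3) :
    Continuous fun p : ℝ × ℝ => value ν i p.1 p.2 := by
  have hc : Continuous fun p : ℝ × ℝ => shares p.1 p.2 i := by
    fin_cases i
    · change Continuous fun p : ℝ × ℝ => zL p.1
      unfold zL
      refine continuous_pi (forall_fin_five ?_ ?_ ?_ ?_ ?_) <;> (dsimp; fun_prop)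
    · change Continuous fun p : ℝ × ℝ => zM p.1 p.2
      unfold zM
      refine continuous_pi (forall_fin_five ?_ ?_ ?_ ?_ ?_) <;> (dsimp; fun_prop)
    · change Continuous fun p : ℝ × ℝ => zR p.1 p.2
      unfold zR
      refine continuous_pi (forall_fin_five ?_ ?_ ?_ ?_ ?_) <;> (dsimp; fun_prop)
  have hsub : Continuous fun p : ℝ × ℝ => (⟨shares p.1 p.2 i, isPreconnected_shares p.1 p.2 i⟩ :
      {z : Fin 5 → ℝ × ℝ // IsPreconnected (arcs z : Set Lips)}) := hc.subtype_mk _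
  exact NNReal.continuous_coe.comp (hν.continuous.comp hsub)

theorem value_eq_zero {ν : TangleValuation Lips} (hν : IsMonotoneContinuous ν) {i : Fin 3}
    {τ q : ℝ} (h : ∀ e, Void (shares τ q i) e ∨ (shares τ q i e).2 ≤ (shares τ q i e).1) :
    value ν i τ q = 0 := by
  unfold value
  rw [hν.eq_zero_of_degenerate h]
  rfl

end Partition

/-! ### Median and minimum of three preferences -/

section Median

/-- The median of three numbers. -/
noncomputable def median (x : Fin 3 → ℝ) : ℝ :=
  max (max (min (x 0) (x 1)) (min (x 0) (x 2))) (min (x 1) (x 2))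

/-- The least of three numbers. -/
noncomputable def least (x : Fin 3 → ℝ) : ℝ := min (min (x 0) (x 1)) (x 2)

theorem median_le_iff {x : Fin 3 → ℝ} {c : ℝ} :
    median x ≤ c ↔ ∀ a b, a ≠ b → x a ≤ c ∨ x b ≤ c := by
  simp only [median, Fin.forall_fin_succ, max_le_iff, min_le_iff]
  simp
  grind

theorem le_median_iff {x : Fin 3 → ℝ} {c : ℝ} :
    c ≤ median x ↔ ∃ a b, a ≠ b ∧ c ≤ x a ∧ c ≤ x b := by
  simp only [median, Fin.exists_fin_succ, le_max_iff, le_min_iff]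
  simp
  grind

theorem least_le_iff {x : Fin 3 → ℝ} {c : ℝ} : least x ≤ c ↔ ∃ a, x a ≤ c := by
  simp only [least, Fin.exists_fin_succ, min_le_iff]
  simp
  grind

theorem le_least_iff {x : Fin 3 → ℝ} {c : ℝ} : c ≤ least x ↔ ∀ a, c ≤ x a := by
  simp only [least, Fin.forall_fin_succ, le_min_iff]
  simp
  grind

theorem median_mono {x y : Fin 3 → ℝ} (h : x ≤ y) : median x ≤ median y :=
  max_le_max (max_le_max (min_le_min (h 0) (h 1)) (min_le_min (h 0) (h 2)))
    (min_le_min (h 1) (h 2))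

/-- If the median is at most `c`, then two of the numbers are. -/
theorem exists_pair_le_of_median_le {x : Fin 3 → ℝ} {c : ℝ} (h : median x ≤ c) :
    ∃ a b, a ≠ b ∧ x a ≤ c ∧ x b ≤ c := by
  rw [median_le_iff] at h
  rcases h 0 1 (by decide) with h1 | h1 <;> rcases h 0 2 (by decide) with h2 | h2 <;>
    rcases h 1 2 (by decide) with h3 | h3
  · exact ⟨0, 1, by decide, h1, h3⟩
  · exact ⟨0, 2, by decide, h1, h3⟩
  · exact ⟨0, 1, by decide, h1, h3⟩
  · exact ⟨0, 2, by decide, h1, h2⟩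
  · exact ⟨0, 1, by decide, h2, h1⟩
  · exact ⟨0, 1, by decide, h2, h1⟩
  · exact ⟨1, 2, by decide, h1, h2⟩
  · exact ⟨1, 2, by decide, h1, h2⟩

/-- Three agents choose among three shares with values `v a 0`, `v a 1`, `v a 2`, if the second
share is as good as the third one for the median agent and if exactly one agent prefers the first
share. -/
theorem exists_perm_of_median_eq_zero {v : Fin 3 → Fin 3 → ℝ}
    (hf : median (fun a => v a 1 - v a 2) = 0)
    (hg : least (fun a => max (v a 1) (v a 2) - v a 0) ≤ 0)
    (hg' : 0 ≤ median fun a => max (v a 1) (v a 2) - v a 0) :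
    ∃ s : Equiv.Perm (Fin 3), ∀ a i, v a i ≤ v a (s a) := by
  have key : ∃ i j k : Fin 3, i ≠ j ∧ i ≠ k ∧ j ≠ k ∧ max (v i 1) (v i 2) ≤ v i 0 ∧
      v j 0 ≤ max (v j 1) (v j 2) ∧ v j 2 ≤ v j 1 ∧ v k 0 ≤ max (v k 1) (v k 2) ∧
      v k 1 ≤ v k 2 := by
    have hthird := (by decide : ∀ p q : Fin 3, p ≠ q →
      ∃ r : Fin 3, r ≠ p ∧ r ≠ q ∧ ∀ a, a = p ∨ a = q ∨ a = r)
    obtain ⟨i, hi, hi'⟩ : ∃ i, max (v i 1) (v i 2) ≤ v i 0 ∧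
        ∀ j, j ≠ i → v j 0 ≤ max (v j 1) (v j 2) := by
      obtain ⟨p, q, hpq, hp, hq⟩ := le_median_iff.1 hg'
      obtain ⟨i, hi⟩ := least_le_iff.1 hg
      obtain ⟨r, -, -, hr⟩ := hthird p q hpq
      rw [sub_nonneg] at hp hq
      rw [sub_nonpos] at hi
      -- Agents `p` and `q` accept waiting. If `r` does too, then all three do, and any agent who
      -- accepts the first share can be `i`.
      rcases le_total (max (v r 1) (v r 2)) (v r 0) with h | h
      · refine ⟨r, h, fun j hj => ?_⟩
        rcases hr j with rfl | rfl | rfl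
        exacts [hp, hq, absurd rfl hj]
      · refine ⟨i, hi, fun j _ => ?_⟩
        rcases hr j with rfl | rfl | rfl
        exacts [hp, hq, h]
    obtain ⟨j, k, hij, hik, hjk, hcov⟩ := (by decide : ∀ i : Fin 3, ∃ j k : Fin 3,
      i ≠ j ∧ i ≠ k ∧ j ≠ k ∧ ∀ a, a = i ∨ a = j ∨ a = k) i
    have hle := median_le_iff.1 hf.le j k hjk
    -- Two agents weakly prefer the second share to the third, and at most one of them is `i`.
    have hge : v j 2 ≤ v j 1 ∨ v k 2 ≤ v k 1 := by
      obtain ⟨p, q, hpq, hp, hq⟩ := le_median_iff.1 hf.ge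
      rw [sub_nonneg] at hp hq
      rcases hcov p with rfl | rfl | rfl
      · rcases hcov q with rfl | rfl | rfl
        exacts [absurd rfl hpq, .inl hq, .inr hq]
      · exact .inl hp
      · exact .inr hp
    simp only [sub_nonpos] at hle
    have hj := hi' j hij.symm
    have hk := hi' k hik.symm
    by_cases h : v j 2 ≤ v j 1 ∧ v k 1 ≤ v k 2
    · exact ⟨i, j, k, hij, hik, hjk, hi, hj, h.1, hk, h.2⟩
    · have : v k 2 ≤ v k 1 ∧ v j 1 ≤ v j 2 := by grind
      exact ⟨i, k, j, hik, hij, hjk.symm, hi, hk, this.1, hj, this.2⟩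
  obtain ⟨i, j, k, hij, hik, hjk, h1, h2, h3, h4, h5⟩ := key
  obtain ⟨s, hsi, hsj, hsk⟩ := (by decide : ∀ i j k : Fin 3, i ≠ j → i ≠ k → j ≠ k →
    ∃ s : Equiv.Perm (Fin 3), s i = 0 ∧ s j = 1 ∧ s k = 2) i j k hij hik hjk
  have hcov := (by decide : ∀ i j k : Fin 3, i ≠ j → i ≠ k → j ≠ k →
    ∀ a, a = i ∨ a = j ∨ a = k) i j k hij hik hjk
  refine ⟨s, fun a => ?_⟩
  rcases hcov a with rfl | rfl | rfl
  · rw [hsi]; intro b; fin_cases b <;> simp <;> grind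
  · rw [hsj]; intro b; fin_cases b <;> simp <;> grind
  · rw [hsk]; intro b; fin_cases b <;> simp <;> grind

end Median

/-! ### Reference pieces and values at extreme positions -/

section MovingKnife

/-- The two edges between `b` and `c`. -/
noncomputable def rightLip : Fin 5 → ℝ × ℝ := ![(1, 0), (1, 0), (0, 1), (0, 1), (1, 0)]

/-- The two edges between `a` and `b`, and the edge between `a` and `c`. -/
noncomputable def leftLipBar : Fin 5 → ℝ × ℝ := ![(0, 1), (0, 1), (1, 0), (1, 0), (0, 1)]

/-- The first edge between `a` and `b`. -/
noncomputable def firstEdge : Fin 5 → ℝ × ℝ := ![(0, 1), (1, 0), (1, 0), (1, 0), (1, 0)]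

/-- The second edge between `a` and `b`. -/
noncomputable def secondEdge : Fin 5 → ℝ × ℝ := ![(1, 0), (0, 1), (1, 0), (1, 0), (1, 0)]

theorem void_one_zero {z : Fin 5 → ℝ × ℝ} (e : Fin 5) (h : z e = (1, 0)) : Void z e :=
  .inl (by rw [h]; exact zero_lt_one)

theorem isPreconnected_rightLip : IsPreconnected (arcs rightLip : Set Lips) :=
  isPreconnected_arcs_of_star 2 (forall_fin_five (.inl (void_one_zero 0 rfl))
    (.inl (void_one_zero 1 rfl)) (void_or_touches_tgt 2 le_rfl) (void_or_touches_tgt 3 le_rfl)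
    (.inl (void_one_zero 4 rfl)))

theorem isPreconnected_leftLipBar : IsPreconnected (arcs leftLipBar : Set Lips) :=
  isPreconnected_star_a le_rfl le_rfl (void_one_zero 2 rfl) (void_one_zero 3 rfl) le_rfl

theorem isPreconnected_firstEdge : IsPreconnected (arcs firstEdge : Set Lips) :=
  isPreconnected_edge_zero (void_one_zero 1 rfl) (void_one_zero 2 rfl) (void_one_zero 3 rfl)
    (void_one_zero 4 rfl)

theorem isPreconnected_secondEdge : IsPreconnected (arcs secondEdge : Set Lips) :=
  isPreconnected_arcs_of_single 1 (forall_fin_five (fun _ => void_one_zero 0 rfl)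
    (fun h => absurd rfl h) (fun _ => void_one_zero 2 rfl) (fun _ => void_one_zero 3 rfl)
    fun _ => void_one_zero 4 rfl)

theorem isPreconnected_whole : IsPreconnected (arcs (fun _ => (0, 1)) : Set Lips) :=
  isPreconnected_hub_ac le_rfl le_rfl le_rfl le_rfl le_rfl le_rfl

theorem arcs_subset_whole (z : Fin 5 → ℝ × ℝ) : (arcs z : Set Lips) ⊆ arcs fun _ => (0, 1) := by
  intro p _
  obtain ⟨e, t, rfl⟩ := exists_edge p
  exact mem_arcs.2 ⟨e, t, t.2, rfl⟩

/-- The arc on the bar contains at most the vertex `c`, which also lies on the right lip. -/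
theorem arcs_subset_rightLip {z : Fin 5 → ℝ × ℝ} (h0 : Void z 0) (h1 : Void z 1)
    (h4 : 1 ≤ (z 4).1) : (arcs z : Set Lips) ⊆ arcs rightLip := by
  intro p hp
  obtain ⟨e, he⟩ := mem_iUnion.1 hp
  have key : ∀ e, p ∈ arc z e → p ∈ (arcs rightLip : Set Lips) := by
    refine forall_fin_five (fun h => absurd h h0.not_mem) (fun h => absurd h h1.not_mem)
      ?_ ?_ ?_
    · rintro ⟨t, -, rfl⟩
      exact mem_arcs.2 ⟨2, t, t.2, rfl⟩
    · rintro ⟨t, -, rfl⟩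
      exact mem_arcs.2 ⟨3, t, t.2, rfl⟩
    · rintro ⟨t, ⟨ht, -⟩, rfl⟩
      obtain rfl : t = 1 := Subtype.ext (le_antisymm t.2.2 (h4.trans ht))
      refine mem_arcs.2 ⟨2, 1, ⟨zero_le_one, le_rfl⟩, edge_eq_edge.2 ?_⟩
      rw [glue_one, glue_one]
      rfl
  exact key e he

theorem arcs_subset_secondEdge {z : Fin 5 → ℝ × ℝ} (h0 : Void z 0) (h2 : Void z 2)
    (h3 : (z 3).2 ≤ 0) (h4 : Void z 4) : (arcs z : Set Lips) ⊆ arcs secondEdge := by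
  intro p hp
  obtain ⟨e, he⟩ := mem_iUnion.1 hp
  have key : ∀ e, p ∈ arc z e → p ∈ (arcs secondEdge : Set Lips) := by
    refine forall_fin_five (fun h => absurd h h0.not_mem) ?_ (fun h => absurd h h2.not_mem) ?_
      (fun h => absurd h h4.not_mem)
    · rintro ⟨t, -, rfl⟩
      exact mem_arcs.2 ⟨1, t, t.2, rfl⟩
    · rintro ⟨t, ⟨-, ht⟩, rfl⟩
      obtain rfl : t = 0 := Subtype.ext (le_antisymm (ht.trans h3) t.2.1)
      refine mem_arcs.2 ⟨1, 1, ⟨zero_le_one, le_rfl⟩, edge_eq_edge.2 ?_⟩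
      rw [glue_zero, glue_one]
      rfl
  exact key e he

section Values

variable {ν : TangleValuation Lips}

theorem value_one_mono (hν : IsMonotoneContinuous ν) (τ : ℝ) : Monotone fun q => value ν 1 τ q := by
  intro q q' h
  refine value_le_value hν (arcs_mono (forall_fin_five ?_ ?_ ?_ ?_ ?_)) <;> right <;>
    simp only [shares, zM, Matrix.cons_val] <;> grind

theorem value_two_anti (hν : IsMonotoneContinuous ν) (τ : ℝ) : Antitone fun q => value ν 2 τ q := by
  intro q q' h
  refine value_le_value hν (arcs_mono (forall_fin_five ?_ ?_ ?_ ?_ ?_)) <;> right <;>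
    simp only [shares, zR, Matrix.cons_val] <;> grind

theorem value_zero_eq_zero (hν : IsMonotoneContinuous ν) (q : ℝ) : value ν 0 0 q = 0 := by
  refine value_eq_zero hν (forall_fin_five ?_ ?_ ?_ ?_ ?_) <;> right <;>
    simp [shares, zL]

theorem value_one_eq_zero (hν : IsMonotoneContinuous ν) {τ q : ℝ} (h : q ≤ τ - 1)
    (h' : q ≤ 0 ∨ 2 ≤ τ) (h'' : q ≤ 1 ∨ q ≤ τ - 2) (h3 : q ≤ 2) : value ν 1 τ q = 0 := by
  refine value_eq_zero hν (forall_fin_five ?_ ?_ ?_ ?_ ?_) <;> right <;>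
    simp only [shares, zM, Matrix.cons_val] <;> grind

/-- The cut at `2 - τ ≥ 1` does not yet return any of the second edge. -/
theorem value_two_eq_zero (hν : IsMonotoneContinuous ν) {τ : ℝ} (h : τ ≤ 1) :
    value ν 2 τ 4 = 0 := by
  refine value_eq_zero hν (forall_fin_five ?_ ?_ ?_ ?_ ?_) <;> right <;>
    simp only [shares, zR, Matrix.cons_val] <;> grind

theorem value_le_whole (hν : IsMonotoneContinuous ν) (i : Fin 3) (τ q : ℝ) :
    value ν i τ q ≤ ν ⟨arcs fun _ => (0, 1), isPreconnected_whole⟩ :=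
  NNReal.coe_le_coe.2 (hν.mono _ _ (arcs_subset_whole _))

theorem value_le_rightLip (hν : IsMonotoneContinuous ν) {q : ℝ} (i : Fin 3) (hi : i ≠ 0) :
    value ν i 4 q ≤ ν ⟨arcs rightLip, isPreconnected_rightLip⟩ := by
  refine NNReal.coe_le_coe.2 (hν.mono _ _ ?_)
  fin_cases i
  · exact absurd rfl hi
  · refine arcs_subset_rightLip ?_ ?_ ?_ <;>
      simp only [shares, zM, Void, Matrix.cons_val, Fin.mk_one] <;> grind
  · refine arcs_subset_rightLip ?_ ?_ ?_ <;>
      simp only [shares, zR, Void, Matrix.cons_val, Fin.reduceFinMk] <;> grind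

theorem leftLipBar_le_value (hν : IsMonotoneContinuous ν) (q : ℝ) :
    ν ⟨arcs leftLipBar, isPreconnected_leftLipBar⟩ ≤ value ν 0 4 q := by
  refine NNReal.coe_le_coe.2 (hν.mono _ _ (arcs_mono ?_))
  refine forall_fin_five (.inr ?_) (.inr ?_) (.inl (void_one_zero 2 rfl))
    (.inl (void_one_zero 3 rfl)) (.inr ?_) <;>
    simp only [shares, zL, leftLipBar, Matrix.cons_val] <;> grind

theorem value_le_secondEdge (hν : IsMonotoneContinuous ν) (τ : ℝ) :
    value ν 2 τ 4 ≤ ν ⟨arcs secondEdge, isPreconnected_secondEdge⟩ := by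
  refine NNReal.coe_le_coe.2 (hν.mono _ _ ?_)
  refine arcs_subset_secondEdge ?_ ?_ ?_ ?_ <;>
    simp only [shares, zR, Void, Matrix.cons_val] <;> grind

theorem firstEdge_le_value (hν : IsMonotoneContinuous ν) {τ : ℝ} (h : 1 ≤ τ) (q : ℝ) :
    ν ⟨arcs firstEdge, isPreconnected_firstEdge⟩ ≤ value ν 0 τ q := by
  refine NNReal.coe_le_coe.2 (hν.mono _ _ (arcs_mono ?_))
  refine forall_fin_five (.inr ?_) (.inl (void_one_zero 1 rfl)) (.inl (void_one_zero 2 rfl))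
    (.inl (void_one_zero 3 rfl)) (.inl (void_one_zero 4 rfl))
  simp only [shares, zL, firstEdge, Matrix.cons_val]
  grind

end Values

end MovingKnife

/-! ### The stopping position and its degenerate cases -/

section MovingKnife

theorem continuous_median {X : Type*} [TopologicalSpace X] {x : X → Fin 3 → ℝ}
    (h : ∀ a, Continuous fun p => x p a) : Continuous fun p => median (x p) :=
  (((h 0).min (h 1)).max ((h 0).min (h 2))).max ((h 1).min (h 2))

theorem continuous_least {X : Type*} [TopologicalSpace X] {x : X → Fin 3 → ℝ}
    (h : ∀ a, Continuous fun p => x p a) : Continuous fun p => least (x p) :=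
  ((h 0).min (h 1)).min (h 2)

/-- By how much an agent prefers the share between the sword and the knife to the one on the right
of the knife. -/
noncomputable def knifeGap (ν : Fin 3 → TangleValuation Lips) (τ q : ℝ) (a : Fin 3) : ℝ :=
  value (ν a) 1 τ q - value (ν a) 2 τ q

/-- By how much an agent prefers waiting to taking the share on the left of the sword. -/
noncomputable def swordGap (ν : Fin 3 → TangleValuation Lips) (τ q : ℝ) (a : Fin 3) : ℝ :=
  max (value (ν a) 1 τ q) (value (ν a) 2 τ q) - value (ν a) 0 τ q

variable {ν : Fin 3 → TangleValuation Lips}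

/-- The moving knife stops at a position where the median agent is indifferent about the knife and
where, unless the sword has hardly moved, no agent prefers the share on the left. -/
theorem exists_stop (hν : ∀ a, IsMonotoneContinuous (ν a)) {a₀ : Fin 3}
    (h₀ : ν a₀ ⟨arcs rightLip, isPreconnected_rightLip⟩ ≤
      ν a₀ ⟨arcs leftLipBar, isPreconnected_leftLipBar⟩) {j k : Fin 3} (hjk : j ≠ k)
    (hj : ν j ⟨arcs secondEdge, isPreconnected_secondEdge⟩ ≤
      ν j ⟨arcs firstEdge, isPreconnected_firstEdge⟩)
    (hk : ν k ⟨arcs secondEdge, isPreconnected_secondEdge⟩ ≤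
      ν k ⟨arcs firstEdge, isPreconnected_firstEdge⟩) :
    ∃ K > 0, ∃ τ ∈ Icc (0 : ℝ) 4, ∃ q ∈ Icc (-1 : ℝ) 4, median (knifeGap ν τ q) = 0 ∧
      max (least (swordGap ν τ q)) (median (swordGap ν τ q) - K * τ) = 0 := by
  -- As `K` bounds all values, `median - K * τ ≤ 0` once `τ ≥ 1`, and the correction no longer
  -- affects the sign condition on `G`.
  obtain ⟨K, hK, hKν⟩ : ∃ K : ℝ, 0 < K ∧
      ∀ a, (ν a ⟨arcs fun _ => (0, 1), isPreconnected_whole⟩ : ℝ) ≤ K := by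
    obtain ⟨c, hc⟩ := Finite.exists_max fun a =>
      (ν a ⟨arcs fun _ => (0, 1), isPreconnected_whole⟩ : ℝ)
    exact ⟨_, by positivity, fun a => (hc a).trans (le_add_of_nonneg_right zero_le_one)⟩
  have hgK : ∀ τ q, median (swordGap ν τ q) ≤ K := fun τ q =>
    median_le_iff.2 fun a _ _ => .inl <| (sub_le_self _ (value_nonneg _ _ _ _)).trans <|
      max_le ((value_le_whole (hν a) _ _ _).trans (hKν a))
        ((value_le_whole (hν a) _ _ _).trans (hKν a))
  have hc := fun a i => continuous_value (hν a) i
  have hcg : ∀ a, Continuous fun p : ℝ × ℝ => swordGap ν p.1 p.2 a := fun a =>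
    ((hc a 1).max (hc a 2)).sub (hc a 0)
  -- With `least` alone, one agent without interest in M and R could produce a useless zero at `τ =
  -- 0`. The second term makes a zero there require two such agents.
  refine ⟨K, hK, exists_common_zero' (a := 0) (b := 4) (c := -1) (d := 4) (by norm_num)
    (by norm_num) (F := fun τ q => median (knifeGap ν τ q))
    (G := fun τ q => max (least (swordGap ν τ q)) (median (swordGap ν τ q) - K * τ))
    (continuous_median fun a => (hc a 1).sub (hc a 2))
    ((continuous_least hcg).max ((continuous_median hcg).sub (by fun_prop)))
    (fun τ q q' h => median_mono fun a =>
      sub_le_sub (value_one_mono (hν a) τ h) (value_two_anti (hν a) τ h)) ?_ ?_ ?_ ?_ ?_⟩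
  · intro τ hτ
    refine median_le_iff.2 fun a _ _ => .inl ?_
    unfold knifeGap
    rw [value_one_eq_zero (hν a) (by linarith [hτ.1]) (by norm_num) (by norm_num) (by norm_num)]
    linarith [value_nonneg (ν a) 2 τ (-1)]
  · refine le_median_iff.2 ⟨0, 1, by decide, ?_, ?_⟩ <;>
    · unfold knifeGap
      rw [value_two_eq_zero (hν _) zero_le_one, sub_zero]
      exact value_nonneg _ _ _ _
  · intro q _
    refine le_max_of_le_left (le_least_iff.2 fun a => ?_)
    unfold swordGap
    rw [value_zero_eq_zero (hν a), sub_zero]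
    exact le_max_of_le_left (value_nonneg _ _ _ _)
  · intro q _
    refine max_le (least_le_iff.2 ⟨a₀, sub_nonpos.2 ?_⟩) (by linarith [hgK 4 q])
    have h := NNReal.coe_le_coe.2 h₀
    have h' := leftLipBar_le_value (hν a₀) q
    exact max_le ((value_le_rightLip (hν a₀) 1 (by decide)).trans (h.trans h'))
      ((value_le_rightLip (hν a₀) 2 (by decide)).trans (h.trans h'))
  · intro τ hτ hf
    -- For `τ < 1` the right share is worthless, so an agent who does not prefer M values both M and
    -- R at 0; every pair of agents contains such an agent.
    rcases lt_or_ge τ 1 with h1 | h1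
    · have hle : ∀ a, knifeGap ν τ 4 a ≤ 0 → swordGap ν τ 4 a ≤ 0 := by
        intro a ha
        unfold knifeGap at ha
        unfold swordGap
        rw [value_two_eq_zero (hν a) h1.le] at ha ⊢
        rw [sub_zero] at ha
        rw [max_eq_right ha]
        linarith [value_nonneg (ν a) 0 τ 4]
      have hmed : median (swordGap ν τ 4) ≤ 0 := median_le_iff.2 fun a b hab =>
        (median_le_iff.1 hf a b hab).imp (hle a) (hle b)
      obtain ⟨a, b, -, ha, -⟩ := exists_pair_le_of_median_le hmed
      exact max_le (least_le_iff.2 ⟨a, ha⟩) (by nlinarith [hτ.1])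
    · refine max_le ?_ (by nlinarith [hgK τ 4])
      have key : ∀ a, ν a ⟨arcs secondEdge, isPreconnected_secondEdge⟩ ≤
          ν a ⟨arcs firstEdge, isPreconnected_firstEdge⟩ → knifeGap ν τ 4 a ≤ 0 →
          least (swordGap ν τ 4) ≤ 0 := by
        intro a ha hfa
        refine least_le_iff.2 ⟨a, sub_nonpos.2 ?_⟩
        rw [max_eq_right (sub_nonpos.1 hfa)]
        exact (value_le_secondEdge (hν a) τ).trans
          ((NNReal.coe_le_coe.2 ha).trans (firstEdge_le_value (hν a) h1 4))
      -- One of `j`, `k` weakly prefers R to M, hence L, which contains the first edge, to both.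
      exact (median_le_iff.1 hf j k hjk).elim (key j hj) (key k hk)

/-- A sword that has not overtaken the knife cuts the left share out of the former middle share. -/
theorem exists_shares_subset_of_unmoved {τ q : ℝ} (h0 : 0 ≤ τ) (h1 : τ ≤ 1 / 2) (h : τ ≤ q + 1)
    (i : Fin 3) : ∃ j, (arcs (shares τ q i) : Set Lips) ⊆ arcs (shares 0 q j) := by
  fin_cases i
  · refine ⟨1, arcs_mono (forall_fin_five ?_ ?_ ?_ ?_ ?_)⟩ <;>
      simp only [shares, zM, zL, Void, Matrix.cons_val, Fin.zero_eta] <;> grind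
  · refine ⟨1, arcs_mono (forall_fin_five ?_ ?_ ?_ ?_ ?_)⟩ <;>
      simp only [shares, zM, Void, Matrix.cons_val, Fin.mk_one] <;> grind
  · refine ⟨2, arcs_mono (forall_fin_five ?_ ?_ ?_ ?_ ?_)⟩ <;>
      simp only [shares, zR, Void, Matrix.cons_val, Fin.reduceFinMk] <;> grind

/-- Two agents do not value the shares on both sides of the knife when the sword has not moved. -/
theorem hasEnvyFree_of_unmoved (hν : ∀ a, IsMonotoneContinuous (ν a)) {q : ℝ}
    (hq : q ∈ Icc (-1 : ℝ) 4) {a b : Fin 3} (hab : a ≠ b)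
    (ha : ∀ i, value (ν a) i 0 q ≤ 0) (hb : ∀ i, value (ν b) i 0 q ≤ 0) : HasEnvyFree ν := by
  rcases hq.1.eq_or_lt with rfl | hq1
  -- Here the right share is everything, so any proper position would serve in place of `(1, 1)`.
  · have hsub : ∀ i, (arcs (shares 1 1 i) : Set Lips) ⊆ arcs (shares 0 (-1) 2) := fun i =>
      (arcs_subset_whole _).trans <| arcs_mono <| forall_fin_five
        (.inr (by simp [shares, zR]))
        (.inr (by simp [shares, zR])) (.inr (by simp [shares, zR]))
        (.inr (by simp [shares, zR])) (.inr (by simp [shares, zR]))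
    refine Proper.hasEnvyFree_of_eq_zero hν (τ := 1) (q := 1)
      ⟨by norm_num, by norm_num, by norm_num, by norm_num⟩ hab
      (fun i => (value_le_value (hν a) (hsub i)).trans (ha 2))
      (fun i => (value_le_value (hν b) (hsub i)).trans (hb 2))
  · obtain ⟨τ, h0, h1, h2⟩ : ∃ τ : ℝ, 0 < τ ∧ τ ≤ 1 / 2 ∧ τ ≤ (1 + q) / 2 :=
      ⟨min (1 / 2) ((1 + q) / 2), lt_min (by norm_num) (by linarith), min_le_left _ _,
        min_le_right _ _⟩
    have hp : Proper τ q :=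
      ⟨h0, by linarith, hq.2, .inl ⟨by linarith, .inr (by linarith)⟩⟩
    have hsub := exists_shares_subset_of_unmoved (q := q) h0.le h1 (by linarith)
    exact hp.hasEnvyFree_of_eq_zero hν hab
      (fun i => (hsub i).elim fun j hj => (value_le_value (hν a) hj).trans (ha j))
      (fun i => (hsub i).elim fun j hj => (value_le_value (hν b) hj).trans (hb j))

/-- When the middle share is degenerate, the right one contains all that the sword has left. -/
theorem arcs_zM_subset_arcs_zR_of_not_proper {τ q : ℝ} (h0 : 0 < τ) (h4 : τ ≤ 4)
    (h : τ < 2 → q ≤ 0 ∧ q ≤ τ - 1) (h' : 2 ≤ τ → q ≤ 1 ∨ q ≤ τ - 2) :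
    (arcs (zM τ 3) : Set Lips) ⊆ arcs (zR τ q) := by
  refine arcs_mono (forall_fin_five ?_ ?_ ?_ ?_ ?_) <;>
    simp only [zM, zR, Void, Matrix.cons_val] <;> grind

theorem arcs_zR_subset_arcs_zR_of_le {τ q : ℝ} (h0 : 0 < τ) (h4 : τ ≤ 4)
    (h : q ≤ 1 ∨ q ≤ τ - 2) : (arcs (zR τ 3) : Set Lips) ⊆ arcs (zR τ q) := by
  have h2 : q ≤ 2 := by grind
  refine arcs_mono (forall_fin_five ?_ ?_ ?_ ?_ ?_) <;>
    simp only [zR, Void, Matrix.cons_val] <;> grind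

theorem le_of_not_proper {τ q : ℝ} (h0 : 0 < τ) (h4 : τ ≤ 4) (hq : q ≤ 4) (h : ¬ Proper τ q) :
    (τ < 2 → q ≤ 0 ∧ q ≤ τ - 1) ∧ (2 ≤ τ → q ≤ 1 ∨ q ≤ τ - 2) := by
  unfold Proper at h
  grind

theorem exists_shares_subset_of_not_proper {τ q : ℝ} (h0 : 0 < τ) (h4 : τ ≤ 4) (hq : q ≤ 4)
    (h : ¬ Proper τ q) (i : Fin 3) :
    ∃ j, j ≠ 1 ∧ (arcs (shares τ 3 i) : Set Lips) ⊆ arcs (shares τ q j) := by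
  obtain ⟨h, h'⟩ := le_of_not_proper h0 h4 hq h
  fin_cases i
  · exact ⟨0, by decide, (subset_rfl : (arcs (zL τ) : Set Lips) ⊆ arcs (zL τ))⟩
  · exact ⟨2, by decide, arcs_zM_subset_arcs_zR_of_not_proper h0 h4 h h'⟩
  · exact ⟨2, by decide, arcs_zR_subset_arcs_zR_of_le h0 h4 (by grind)⟩

/-- Two agents do not value the shares on both sides of the sword when there is no share between the
sword and the knife. -/
theorem hasEnvyFree_of_not_proper (hν : ∀ a, IsMonotoneContinuous (ν a)) {τ q : ℝ} (h0 : 0 < τ)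
    (h4 : τ ≤ 4) (hq : q ≤ 4) (h : ¬ Proper τ q) {a b : Fin 3} (hab : a ≠ b)
    (ha : ∀ i, i ≠ 1 → value (ν a) i τ q ≤ 0) (hb : ∀ i, i ≠ 1 → value (ν b) i τ q ≤ 0) :
    HasEnvyFree ν := by
  -- The knife position 3 is proper for every `τ` in `(0, 4]`.
  have hp : Proper τ 3 := ⟨h0, h4, by norm_num, by grind⟩
  have hsub := exists_shares_subset_of_not_proper h0 h4 hq h
  exact hp.hasEnvyFree_of_eq_zero hν hab
    (fun i => (hsub i).elim fun j hj => (value_le_value (hν a) hj.2).trans (ha j hj.1))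
    (fun i => (hsub i).elim fun j hj => (value_le_value (hν b) hj.2).trans (hb j hj.1))

/-- The moving knife procedure, for agents of whom one prefers the two edges between `a` and `b`
together with the edge between `a` and `c` to the other two edges, and two prefer the first edge
between `a` and `b` to the second one. -/
theorem hasEnvyFree_of_preferences (hν : ∀ a, IsMonotoneContinuous (ν a)) {a₀ : Fin 3}
    (h₀ : ν a₀ ⟨arcs rightLip, isPreconnected_rightLip⟩ ≤
      ν a₀ ⟨arcs leftLipBar, isPreconnected_leftLipBar⟩) {j k : Fin 3} (hjk : j ≠ k)
    (hj : ν j ⟨arcs secondEdge, isPreconnected_secondEdge⟩ ≤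
      ν j ⟨arcs firstEdge, isPreconnected_firstEdge⟩)
    (hk : ν k ⟨arcs secondEdge, isPreconnected_secondEdge⟩ ≤
      ν k ⟨arcs firstEdge, isPreconnected_firstEdge⟩) : HasEnvyFree ν := by
  obtain ⟨K, hK, τ, hτ, q, hq, hf, hG⟩ := exists_stop hν h₀ hjk hj hk
  have hleast : least (swordGap ν τ q) ≤ 0 := (le_max_left _ _).trans hG.le
  have hmed : median (swordGap ν τ q) ≤ K * τ := sub_nonpos.1 ((le_max_right _ _).trans hG.le)
  have hcase : 0 ≤ least (swordGap ν τ q) ∨ K * τ ≤ median (swordGap ν τ q) :=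
    (le_max_iff.1 hG.ge).imp_right sub_nonneg.1
  rcases hτ.1.eq_or_lt with rfl | hτ0
  · obtain ⟨a, b, hab, ha, hb⟩ := exists_pair_le_of_median_le hmed
    have key : ∀ a, swordGap ν 0 q a ≤ K * 0 → ∀ i, value (ν a) i 0 q ≤ 0 := by
      intro a ha
      have h0 := value_zero_eq_zero (hν a) q
      unfold swordGap at ha
      rw [h0, mul_zero, sub_zero, max_le_iff] at ha
      intro i
      fin_cases i
      exacts [h0.le, ha.1, ha.2]
    exact hasEnvyFree_of_unmoved hν hq hab (key a ha) (key b hb)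
  by_cases hp : Proper τ q
  · obtain ⟨s, hs⟩ := exists_perm_of_median_eq_zero (v := fun a i => value (ν a) i τ q) hf
        hleast <| by
      refine hcase.elim (fun h => ?_) fun h => le_trans (by positivity) h
      exact le_median_iff.2 ⟨0, 1, by decide, le_least_iff.1 h 0, le_least_iff.1 h 1⟩
    exact hp.hasEnvyFree hν s hs
  · have hM : ∀ a, value (ν a) 1 τ q = 0 := fun a => by
      have h := hp
      unfold Proper at h
      have := hτ.2
      have := hq.2
      exact value_one_eq_zero (hν a) (by grind) (by grind) (by grind) (by grind)
    obtain ⟨a, b, hab, ha, hb⟩ := le_median_iff.1 hf.ge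
    have hR : ∀ a, 0 ≤ knifeGap ν τ q a → value (ν a) 2 τ q ≤ 0 := fun a ha => by
      unfold knifeGap at ha
      rw [hM a] at ha
      linarith
    have hg : ∀ a, 0 ≤ knifeGap ν τ q a → swordGap ν τ q a ≤ - value (ν a) 0 τ q := fun a ha => by
      unfold swordGap
      rw [hM a, max_eq_left (hR a ha), zero_sub]
    -- Otherwise `median ≥ K * τ > 0` would require two agents with positive `swordGap`, but `a` and
    -- `b` have none.
    have hall : 0 ≤ least (swordGap ν τ q) := by
      refine hcase.resolve_right fun h => ?_
      have hpos : 0 < K * τ := by positivity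
      have hnot : ∀ a, 0 ≤ knifeGap ν τ q a → swordGap ν τ q a < K * τ := fun a ha =>
        ((hg a ha).trans (neg_nonpos.2 (value_nonneg _ _ _ _))).trans_lt hpos
      obtain ⟨c, d, hcd, hc, hd⟩ := le_median_iff.1 h
      have hca : c ≠ a := fun e => (hnot a ha).not_ge (e ▸ hc)
      have hcb : c ≠ b := fun e => (hnot b hb).not_ge (e ▸ hc)
      have hda : d ≠ a := fun e => (hnot a ha).not_ge (e ▸ hd)
      have hdb : d ≠ b := fun e => (hnot b hb).not_ge (e ▸ hd)
      omega
    have hzero : ∀ a, 0 ≤ knifeGap ν τ q a → ∀ i, i ≠ 1 → value (ν a) i τ q ≤ 0 := by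
      intro a ha i hi
      fin_cases i
      · exact neg_nonneg.1 ((le_least_iff.1 hall a).trans (hg a ha))
      · exact absurd rfl hi
      · exact hR a ha
    exact hasEnvyFree_of_not_proper hν hτ0 hτ.2 hq.2 hp hab (hzero a ha) (hzero b hb)

/-! ### Obtaining the required preferences by symmetry -/

theorem swap_image_secondEdge : swap '' arcs secondEdge = arcs firstEdge := by
  rw [swap_image_arcs]
  congr 1
  ext e : 1
  fin_cases e <;> rfl

theorem swap_image_firstEdge : swap '' arcs firstEdge = arcs secondEdge := by
  rw [swap_image_arcs]
  congr 1
  ext e : 1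
  fin_cases e <;> rfl

theorem swap_image_rightLip : swap '' arcs rightLip = arcs rightLip := by
  rw [swap_image_arcs]
  congr 1
  ext e : 1
  fin_cases e <;> rfl

theorem swap_image_leftLipBar : swap '' arcs leftLipBar = arcs leftLipBar := by
  rw [swap_image_arcs]
  congr 1
  ext e : 1
  fin_cases e <;> rfl

theorem pullback_apply {T : Type*} [TopologicalSpace T] {φ : T → T} (hφ : Continuous φ)
    (ν : TangleValuation T) {X Y : Set T} (hX : IsPreconnected X) (hY : IsPreconnected Y)
    (h : φ '' X = Y) : pullback φ hφ ν ⟨X, hX⟩ = ν ⟨Y, hY⟩ := by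
  subst h
  rfl

theorem hasEnvyFree_of_le (hν : ∀ a, IsMonotoneContinuous (ν a)) {a₀ : Fin 3}
    (h₀ : ν a₀ ⟨arcs rightLip, isPreconnected_rightLip⟩ ≤
      ν a₀ ⟨arcs leftLipBar, isPreconnected_leftLipBar⟩) : HasEnvyFree ν := by
  -- By pigeonhole two of the three agents agree on which of the two edges is at least as good;
  -- `swap` makes it the first.
  have key : (∃ j k, j ≠ k ∧
      ν j ⟨arcs secondEdge, isPreconnected_secondEdge⟩ ≤
        ν j ⟨arcs firstEdge, isPreconnected_firstEdge⟩ ∧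
      ν k ⟨arcs secondEdge, isPreconnected_secondEdge⟩ ≤
        ν k ⟨arcs firstEdge, isPreconnected_firstEdge⟩) ∨ ∃ j k, j ≠ k ∧
      ν j ⟨arcs firstEdge, isPreconnected_firstEdge⟩ ≤
        ν j ⟨arcs secondEdge, isPreconnected_secondEdge⟩ ∧
      ν k ⟨arcs firstEdge, isPreconnected_firstEdge⟩ ≤
        ν k ⟨arcs secondEdge, isPreconnected_secondEdge⟩ := by
    set x : Fin 3 → ℝ≥0 := fun a => ν a ⟨arcs firstEdge, isPreconnected_firstEdge⟩ with hx
    set y : Fin 3 → ℝ≥0 := fun a => ν a ⟨arcs secondEdge, isPreconnected_secondEdge⟩ with hy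
    change (∃ j k, j ≠ k ∧ y j ≤ x j ∧ y k ≤ x k) ∨ ∃ j k, j ≠ k ∧ x j ≤ y j ∧ x k ≤ y k
    rcases le_total (x 0) (y 0) with h0 | h0 <;> rcases le_total (x 1) (y 1) with h1 | h1 <;>
      rcases le_total (x 2) (y 2) with h2 | h2
    · exact .inr ⟨0, 1, by decide, h0, h1⟩
    · exact .inr ⟨0, 1, by decide, h0, h1⟩
    · exact .inr ⟨0, 2, by decide, h0, h2⟩
    · exact .inl ⟨1, 2, by decide, h1, h2⟩
    · exact .inr ⟨1, 2, by decide, h1, h2⟩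
    · exact .inl ⟨0, 2, by decide, h0, h2⟩
    · exact .inl ⟨0, 1, by decide, h0, h1⟩
    · exact .inl ⟨0, 1, by decide, h0, h1⟩
  rcases key with ⟨j, k, hjk, hj, hk⟩ | ⟨j, k, hjk, hj, hk⟩
  · exact hasEnvyFree_of_preferences hν h₀ hjk hj hk
  · refine HasEnvyFree.of_pullback continuous_swap bijective_swap
      (hasEnvyFree_of_preferences (fun a => (hν a).pullback_swap) (a₀ := a₀) ?_ hjk ?_ ?_)
    · rwa [pullback_apply _ _ _ isPreconnected_rightLip swap_image_rightLip,
        pullback_apply _ _ _ isPreconnected_leftLipBar swap_image_leftLipBar]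
    · rwa [pullback_apply _ _ _ isPreconnected_firstEdge swap_image_secondEdge,
        pullback_apply _ _ _ isPreconnected_secondEdge swap_image_firstEdge]
    · rwa [pullback_apply _ _ _ isPreconnected_firstEdge swap_image_secondEdge,
        pullback_apply _ _ _ isPreconnected_secondEdge swap_image_firstEdge]

theorem mirror_image_rightLip_subset : mirror '' arcs rightLip ⊆ arcs leftLipBar := by
  rw [mirror_image_arcs]
  refine arcs_mono (forall_fin_five ?_ ?_ ?_ ?_ ?_) <;> simp [rightLip, leftLipBar, Void]

theorem rightLip_subset_mirror_image : arcs rightLip ⊆ mirror '' arcs leftLipBar := by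
  rw [mirror_image_arcs]
  refine arcs_mono (forall_fin_five ?_ ?_ ?_ ?_ ?_) <;> simp [rightLip, leftLipBar, Void]

/-- An agent who weakly prefers the right lip to the left lip with the bar also prefers, by
monotonicity, the right lip with the bar to the left lip. This is the required preference after
`mirror`. -/
theorem hasEnvyFree_lips (hν : ∀ a, IsMonotoneContinuous (ν a)) : HasEnvyFree ν := by
  rcases le_total (ν 0 ⟨arcs rightLip, isPreconnected_rightLip⟩)
    (ν 0 ⟨arcs leftLipBar, isPreconnected_leftLipBar⟩) with h | h
  · exact hasEnvyFree_of_le hν h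
  · refine HasEnvyFree.of_pullback continuous_mirror bijective_mirror
      (hasEnvyFree_of_le (fun a => (hν a).pullback_mirror) (a₀ := 0) ?_)
    exact ((hν 0).mono _ _ mirror_image_rightLip_subset).trans
      (h.trans ((hν 0).mono _ _ rightLip_subset_mirror_image))

end MovingKnife

end Tangle

/-- Three agents with monotone continuous valuations over the lips tangle: the lips can be
partitioned into three (nonempty) connected shares, one for each agent, without envy. -/
theorem mainTheorem5 (ν : Fin 3 → TangleValuation Tangle.Lips)
    (hν : ∀ i, Tangle.IsMonotoneContinuous (ν i)) :
    ∃ A : Fin 3 → ConnectedSubset Tangle.Lips,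
      (∀ i, (A i).1.Nonempty) ∧
      (∀ i j, i ≠ j → Disjoint (A i).1 (A j).1) ∧
      (⋃ i, (A i).1) = Set.univ ∧
      ∀ i j, ν i (A j) ≤ ν i (A i) := by
  exact Tangle.hasEnvyFree_lips hν
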